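/- **Setup.** Let $n$ be an even positive integer and let $\Pi_n=\{\pi\in S_n:\pi^2=\mathrm{id},\ \pi(i)\neq i\ \forall i\}$ be the set of fixed-point-free involutions of $\{1,\dots,n\}$. For a real array $E=((e_{ij}))_{1\le i,j\le n}$ let $\sigma_E^2=\operatorname{Var}\big(\sum_i e_{i\pi(i)}\big)$ with $\pi$ uniform on $\Pi_n$. Put $\widehat e_{ii}=0$ and $$\widehat e_{ij}=e_{ij}-\frac{e_{i+}}{n-2}-\frac{e_{+j}}{n-2}+\frac{e_{++}}{(n-1)(n-2)}\quad(i\ne j),\qquad \beta_E=\sum_{i\neq j}\frac{|\widehat e_{ij}|^3}{\sigma_E^3},$$ where a subscript $+$ denotes summation over that index. Let $D=((d_{ij}))_{1\le i,j\le n}$ be a real array with $d_{ij}=d_{ji}$, $d_{ii}=0$, $\sum_j d_{ij}=0$ for all $i,j$, and $\sigma_D^2=1$ (so that $\beta_D=\sum_{i\ne j}|d_{ij}|^3$). Products of permutations are compositions, $\tau_{i,j}$ is the transposition of $i$ and $j$ (with $\tau_{i,i}=\mathrm{id}$), and $\alpha^\pi_{i,j}=\tau_{i,\pi(j)}\tau_{j,\pi(i)}$.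 On a probability space, let $\pi$ be uniform on $\Pi_n$, and let $(I,J,K,L)$ (written $(I^\dagger,J^\dagger,K^\dagger,L^\dagger)$ in full) be independent of $\pi$, with distribution $$p(i,j,k,l)\ \propto\ [d_{ik}+d_{jl}-(d_{ij}+d_{kl})]^2\,\mathbf 1(i,j,k,l\text{ distinct}).$$ Define $$\pi^\dagger=\begin{cases} \pi\alpha^\pi_{J,L}&\text{if }\pi(I)=K,\ \pi(J)\ne L\\ \pi\alpha^\pi_{I,K}&\text{if }\pi(I)\ne K,\ \pi(J)=L\\ \pi\alpha^\pi_{J,K}\tau_{I,J}\tau_{K,L}&\text{if }\pi(I)=L,\ \pi(J)\ne K\\ \pi\alpha^\pi_{I,L}\tau_{I,J}\tau_{K,L}&\text{if }\pi(I)\ne L,\ \pi(J)=K\\ \pi\alpha^\pi_{K,L}\tau_{I,L}\tau_{J,K}&\text{if }\pi(I)=J,\ \pi(K)\ne L\\ \pi\alpha^\pi_{I,J}\tau_{I,L}\tau_{J,K}&\text{if }\pi(I)\ne J,\ \pi(K)=L\\ \pi&\text{if }\pi(I)=K,\ \pi(J)=L\\ \pi\tau_{I,L}\tau_{J,K}&\text{if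 }\pi(I)=J,\ \pi(K)=L\\ \pi\tau_{I,J}\tau_{K,L}&\text{if }\pi(I)=L,\ \pi(J)=K\\ \pi\alpha^\pi_{I,K}\alpha^\pi_{J,L}&\text{otherwise,} \end{cases}\qquad \pi^\ddagger=\pi^\dagger\alpha^{\pi^\dagger}_{I,J}.$$ Let $W=\sum_i d_{i\pi(i)}$, $W^\dagger=\sum_i d_{i\pi^\dagger(i)}$, $W^\ddagger=\sum_i d_{i\pi^\ddagger(i)}$, let $U$ be uniform on $[0,1]$ and independent of $(W^\dagger,W^\ddagger)$, and let $W^*=UW^\dagger+(1-U)W^\ddagger$. Finally let $\mathcal I=\{I,J,K,L,\pi(I),\pi(J),\pi(K),\pi(L)\}$ and $$S=\sum_{i\notin\mathcal I}d_{i\pi(i)},\quad T=\sum_{i\in\mathcal I}d_{i\pi(i)},\quad T^\dagger=\sum_{i\in\mathcal I}d_{i\pi^\dagger(i)},\quad T^\ddagger=\sum_{i\in\mathcal I}d_{i\pi^\ddagger(i)}.$$ **Theorem.** Almost surely $$W=S+T,\qquad W^\dagger=S+T^\dagger,\qquad W^\ddagger=S+T^\ddagger.$$ Moreover $W^*$ has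 the $W$-zero bias distribution: $W$ has mean zero and finite variance, and $E[Wf(W)]=\operatorname{Var}(W)\,E[f'(W^*)]$ for every differentiable $f:\mathbb R\to\mathbb R$ for which both expectations exist. Finally, if $n\ge 9$, then $W-W^*$ is integrable and $$E|W-W^*|\le 112\,\frac{\beta_D}{n}+672\,\frac{\beta_D}{n^2}+192\,\frac{\beta_D}{n^3}.$$ -/

import Mathlib

open MeasureTheory ProbabilityTheory

noncomputable section

/-- Permutations of a finite set carry the discrete σ-algebra. -/
instance permFinMeasurableSpace (n : ℕ) : MeasurableSpace (Equiv.Perm (Fin n)) := ⊤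

/-- `Π_n`: the involutions of `{1, …, n}` without fixed points. -/
def fpfInvolutions (n : ℕ) : Finset (Equiv.Perm (Fin n)) :=
  Finset.univ.filter fun π => π * π = 1 ∧ ∀ i, π i ≠ i

/-- `Y_E = ∑ i, e_{i π(i)}` as a function of the permutation. -/
def permSum {n : ℕ} (e : Fin n → Fin n → ℝ) (π : Equiv.Perm (Fin n)) : ℝ :=
  ∑ i, e i (π i)

/-- `σ_E² = Var(Y_E)`, where `π` is uniform on `Π_n`. -/
def sigmaSq {n : ℕ} (e : Fin n → Fin n → ℝ) : ℝ :=
  Var[permSum e; uniformOn (fpfInvolutions n : Set (Equiv.Perm (Fin n)))]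

/-- The centred array `ê`. -/
def hatArray {n : ℕ} (e : Fin n → Fin n → ℝ) (i j : Fin n) : ℝ :=
  if i = j then 0
  else e i j - (∑ k, e i k) / ((n : ℝ) - 2) - (∑ k, e k j) / ((n : ℝ) - 2)
    + (∑ k, ∑ l, e k l) / (((n : ℝ) - 1) * ((n : ℝ) - 2))

/-- `β_E = ∑_{i ≠ j} |ê_{ij}|³ / σ_E³`. -/
def betaArray {n : ℕ} (e : Fin n → Fin n → ℝ) : ℝ :=
  ∑ i, ∑ j, if i ≠ j then |hatArray e i j| ^ 3 / Real.sqrt (sigmaSq e) ^ 3 else 0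

/-- The standing conditions on `D`: symmetric, zero diagonal, zero row sums, `σ_D² = 1`. -/
structure IsStandardArray {n : ℕ} (d : Fin n → Fin n → ℝ) : Prop where
  symm : ∀ i j, d i j = d j i
  diag : ∀ i, d i i = 0
  row_sum : ∀ i, ∑ j, d i j = 0
  sigmaSq_eq_one : sigmaSq d = 1

/-- `α^π_{i,j} = τ_{i,π(j)} τ_{j,π(i)}`; products of permutations are compositions. -/
def alphaPerm {n : ℕ} (π : Equiv.Perm (Fin n)) (i j : Fin n) : Equiv.Perm (Fin n) :=
  Equiv.swap i (π j) * Equiv.swap j (π i)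

/-- The square `[d_{ik} + d_{jl} - (d_{ij} + d_{kl})]²` on quadruples of distinct indices,
and `0` on the other quadruples. -/
def quadWeight {n : ℕ} (d : Fin n → Fin n → ℝ) (i j k l : Fin n) : ℝ :=
  if ({i, j, k, l} : Finset (Fin n)).card = 4 then
    (d i k + d j l - (d i j + d k l)) ^ 2
  else 0

/-- The probability mass function `p(i,j,k,l)`, proportional to `quadWeight`. -/
def quadProb {n : ℕ} (d : Fin n → Fin n → ℝ) (i j k l : Fin n) : ℝ :=
  quadWeight d i j k l / ∑ i', ∑ j', ∑ k', ∑ l', quadWeight d i' j' k' l'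

/-- The permutation `π†`. For `π ∈ Π_n` and distinct `i, j, k, l` the ten cases are
mutually exclusive, and the last one is the case `R₁ = R₂ = 0`, in which `π` maps none of
`i, j, k, l` into `{i, j, k, l}`. -/
def piDag {n : ℕ} (π : Equiv.Perm (Fin n)) (i j k l : Fin n) : Equiv.Perm (Fin n) :=
  if π i = k ∧ π j ≠ l then π * alphaPerm π j l
  else if π i ≠ k ∧ π j = l then π * alphaPerm π i k
  else if π i = l ∧ π j ≠ k then
    π * alphaPerm π j k * Equiv.swap i j * Equiv.swap k l
  else if π i ≠ l ∧ π j = k then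
    π * alphaPerm π i l * Equiv.swap i j * Equiv.swap k l
  else if π i = j ∧ π k ≠ l then
    π * alphaPerm π k l * Equiv.swap i l * Equiv.swap j k
  else if π i ≠ j ∧ π k = l then
    π * alphaPerm π i j * Equiv.swap i l * Equiv.swap j k
  else if π i = k ∧ π j = l then π
  else if π i = j ∧ π k = l then π * Equiv.swap i l * Equiv.swap j k
  else if π i = l ∧ π j = k then π * Equiv.swap i j * Equiv.swap k l
  else π * alphaPerm π i k * alphaPerm π j l

/-- The permutation `π‡ = π† α^{π†}_{i,j}`. -/
def piDDag {n : ℕ} (π : Equiv.Perm (Fin n)) (i j k l : Fin n) : Equiv.Perm (Fin n) :=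
  piDag π i j k l * alphaPerm (piDag π i j k l) i j

/-- The index set `𝓘 = {i, j, k, l, π(i), π(j), π(k), π(l)}`. -/
def indexSet {n : ℕ} (π : Equiv.Perm (Fin n)) (i j k l : Fin n) : Finset (Fin n) :=
  {i, j, k, l, π i, π j, π k, π l}

/-- The random input of the coupling: `π` is uniform on `Π_n`, the quadruple `(I†, J†, K†, L†)`
has law `p`, and the two are independent. -/
structure IsCouplingInput {n : ℕ} {Ω : Type*} [MeasurableSpace Ω] (P : Measure Ω)
    (d : Fin n → Fin n → ℝ) (π : Ω → Equiv.Perm (Fin n)) (I J K L : Ω → Fin n) : Prop where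
  measurable_perm : Measurable π
  measurable_I : Measurable I
  measurable_J : Measurable J
  measurable_K : Measurable K
  measurable_L : Measurable L
  law_perm : P.map π = uniformOn (fpfInvolutions n : Set (Equiv.Perm (Fin n)))
  law_indices : ∀ i j k l,
    P.real {ω | I ω = i ∧ J ω = j ∧ K ω = k ∧ L ω = l} = quadProb d i j k l
  indep : IndepFun π (fun ω => (I ω, J ω, K ω, L ω)) P

/-- `Ws` has the `W`-zero bias distribution: `W` has mean zero and finite variance, and
`E[W f(W)] = Var(W) E[f'(Ws)]` for every differentiable `f` for which both expectations exist. -/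
structure HasZeroBiasDistribution {Ω : Type*} [MeasurableSpace Ω] (P : Measure Ω)
    (W Ws : Ω → ℝ) : Prop where
  memLp : MemLp W 2 P
  mean_zero : ∫ ω, W ω ∂P = 0
  aemeasurable : AEMeasurable Ws P
  integral_eq : ∀ f : ℝ → ℝ, Differentiable ℝ f →
    Integrable (fun ω => W ω * f (W ω)) P →
    Integrable (fun ω => deriv f (Ws ω)) P →
    ∫ ω, W ω * f (W ω) ∂P = Var[W; P] * ∫ ω, deriv f (Ws ω) ∂P

end

/-!
The argument rests on one operation on fixed-point-free involutions: `switch π i j = π α^π_{i,j}`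
re-matches the pairs of `i` and `j` so that `i` is matched with `j`, and it is a conjugate of `π`
(`switch_eq_conj`).

*Zero bias.* The map `(π, i, j) ↦ (switch π i j, i, π i)` is an involution of the triples with
`i ≠ j`. Hence the pair `W(π), W(switch π i j)` is exchangeable under counting measure, and summing
out `i, j` yields the Stein identity `sum_permSum_sub_mul_sub`. Since
`W(π) - W(switch π i j)` is twice `d_{ik} + d_{jl} - d_{ij} - d_{kl}` with `k = π i`, `l = π j`, the
law `p` is the square bias of this difference. Given a quadruple with law `p`, the missing
ingredient is a uniform element of `constrained i j k l`, the involutions sending `i` to `k` and `j`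
to `l`; `π†` is one. It lies there (`piDag_mem`, a case check in which every case is a
conjugate of `π`), and it is uniform there for reasons of symmetry, with no counting of fibres: the
construction commutes with conjugation (`piDag_conj`), and the permutations fixing `i, j, k, l`
act transitively on `constrained i j k l` because two fixed-point-free involutions of the remaining
points have the same cycle type (`exists_perm_conj_eq`, `sum_comp_piDag`). Integrating `f'` over the
segment from `W‡` to `W†` gives the difference quotient of `f`, whose mean is then read off from the
Stein identity (`couplingMean_diffQuot`).

*The bound.* As `U` need not be independent of `W`, the distance `|W - W*|` is first bounded
pointwise by `gapBound`, uniformly in `U ∈ [0, 1]`. Its three parts have the following means.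
* The pairs of `π` at `I, J, K, L`: here `π` is independent of the indices, and the marginals of
  `p` are dominated by sums over *all* quadruples, in which every cross term vanishes because the
  rows of `d` sum to zero (`sum_quad_sq`).
* The entries of `d` at pairs of `I, J, K, L`: a pointwise inequality of third powers
  (`sq_mul_max_le`).
* The remaining pairs of `π†`: by conjugation symmetry each is equally likely to be any pair outside
  `I, J, K, L` (`card_pair_mul_le`), which leaves `∑ |d_{ij}|`; it is compared with `β` through
  `∑ d_{ij}²`, which the normalisation bounds below (`le_totalWeight`, `totalWeight_le`).
-/

/-! ### Switching the pairs of an involution -/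

theorem mem_fpf {n : ℕ} {π : Equiv.Perm (Fin n)} :
    π ∈ fpfInvolutions n ↔ (∀ i, π (π i) = i) ∧ ∀ i, π i ≠ i := by
  simp only [fpfInvolutions, Finset.mem_filter, Finset.mem_univ, true_and]
  refine and_congr_left fun _ => ?_
  rw [Equiv.ext_iff]
  rfl

theorem mul_swap_eq {n : ℕ} (π : Equiv.Perm (Fin n)) (a b : Fin n) :
    π * Equiv.swap a b = Equiv.swap (π a) (π b) * π := by
  rw [Equiv.swap_apply_apply]; group

theorem conj_mem_fpf {n : ℕ} {π : Equiv.Perm (Fin n)} (hπ : π ∈ fpfInvolutions n)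
    (g : Equiv.Perm (Fin n)) : g * π * g⁻¹ ∈ fpfInvolutions n := by
  rw [mem_fpf] at hπ ⊢
  refine ⟨fun i => by simp [hπ.1], fun i h => hπ.2 (g⁻¹ i) ?_⟩
  apply g.injective
  simpa using h

/-- The permutation `π α^π_{i,j}`. For `π ∈ Π_n` it replaces the pairs `{i, π i}`, `{j, π j}` by
`{i, j}`, `{π i, π j}`; when `i = j` or `π i = j` it is `π` itself. -/
def switch {n : ℕ} (π : Equiv.Perm (Fin n)) (i j : Fin n) : Equiv.Perm (Fin n) :=
  π * alphaPerm π i j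

theorem switch_eq_conj {n : ℕ} {π : Equiv.Perm (Fin n)} (hπ : π ∈ fpfInvolutions n)
    (i j : Fin n) :
    switch π i j = Equiv.swap j (π i) * π * (Equiv.swap j (π i))⁻¹ := by
  rw [mem_fpf] at hπ
  rw [switch, alphaPerm, ← mul_assoc, mul_swap_eq π, hπ.1, Equiv.swap_inv, Equiv.swap_comm (π i) j]

theorem switch_mem_fpf {n : ℕ} {π : Equiv.Perm (Fin n)} (hπ : π ∈ fpfInvolutions n)
    (i j : Fin n) : switch π i j ∈ fpfInvolutions n := by
  rw [switch_eq_conj hπ]; exact conj_mem_fpf hπ _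

theorem switch_apply_left {n : ℕ} {π : Equiv.Perm (Fin n)} (hπ : π ∈ fpfInvolutions n)
    {i j : Fin n} (hij : i ≠ j) : switch π i j i = j := by
  rw [switch_eq_conj hπ]
  rw [mem_fpf] at hπ
  simp [Equiv.swap_apply_of_ne_of_ne hij (hπ.2 i).symm]

theorem switch_apply_right {n : ℕ} {π : Equiv.Perm (Fin n)} (hπ : π ∈ fpfInvolutions n)
    {i j : Fin n} (hij : i ≠ j) : switch π i j j = i := by
  have h := (mem_fpf.1 (switch_mem_fpf hπ i j)).1 i
  rwa [switch_apply_left hπ hij] at h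

theorem switch_apply_of_ne {n : ℕ} (π : Equiv.Perm (Fin n))
    {i j m : Fin n} (h1 : m ≠ i) (h2 : m ≠ j) (h3 : m ≠ π i) (h4 : m ≠ π j) :
    switch π i j m = π m := by
  simp [switch, alphaPerm, Equiv.swap_apply_of_ne_of_ne, *]

theorem switch_apply_apply {n : ℕ} {π : Equiv.Perm (Fin n)} (hπ : π ∈ fpfInvolutions n)
    {i j : Fin n} (hij : i ≠ j) : switch π i j (π i) = π j := by
  rw [switch_eq_conj hπ]
  rw [mem_fpf] at hπ
  have h1 : π j ≠ π i := fun e => hij (π.injective e.symm)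
  simp [Equiv.swap_apply_of_ne_of_ne (hπ.2 j) h1]

theorem switch_eq_self {n : ℕ} {π : Equiv.Perm (Fin n)} (hπ : π ∈ fpfInvolutions n)
    {i j : Fin n} (h : π i = j) : switch π i j = π := by
  rw [switch_eq_conj hπ, h, Equiv.swap_self]; rfl

theorem switch_self {n : ℕ} (π : Equiv.Perm (Fin n)) (i : Fin n) : switch π i i = π := by
  simp [switch, alphaPerm]

theorem switch_switch {n : ℕ} {π : Equiv.Perm (Fin n)} (hπ : π ∈ fpfInvolutions n)
    {i j : Fin n} (hij : i ≠ j) : switch (switch π i j) i (π i) = π := by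
  rw [switch_eq_conj (switch_mem_fpf hπ i j), switch_apply_left hπ hij, switch_eq_conj hπ,
    Equiv.swap_comm (π i) j, Equiv.swap_inv, mul_assoc, mul_assoc, ← mul_assoc, ← mul_assoc]
  simp [mul_assoc]

/-! ### The involution `π†` -/

theorem conj_apply_apply {n : ℕ} (g π : Equiv.Perm (Fin n)) (a : Fin n) :
    (g * π * g⁻¹) (g a) = g (π a) := by simp

theorem alphaPerm_conj {n : ℕ} (g π : Equiv.Perm (Fin n)) (i j : Fin n) :
    alphaPerm (g * π * g⁻¹) (g i) (g j) = g * alphaPerm π i j * g⁻¹ := by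
  rw [alphaPerm, conj_apply_apply, conj_apply_apply, Equiv.swap_apply_apply,
    Equiv.swap_apply_apply, alphaPerm]
  simp only [mul_assoc, inv_mul_cancel_left]

theorem ite_eq_map_ite {α β : Type*} {p q : Prop} [Decidable p] [Decidable q] {f : α → β}
    {x y : β} {x' y' : α} (h : p ↔ q) (hx : x = f x') (hy : y = f y') :
    (if p then x else y) = f (if q then x' else y') := by
  by_cases hq : q
  · rw [if_pos (h.2 hq), if_pos hq, hx]
  · rw [if_neg (mt h.1 hq), if_neg hq, hy]

/-- The construction of `π†` is equivariant under relabelling all points by `g`. -/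
theorem piDag_conj {n : ℕ} (g π : Equiv.Perm (Fin n)) (i j k l : Fin n) :
    piDag (g * π * g⁻¹) (g i) (g j) (g k) (g l) = g * piDag π i j k l * g⁻¹ := by
  obtain ⟨φ, hφ⟩ : ∃ φ : Equiv.Perm (Fin n) → Equiv.Perm (Fin n), ∀ x, φ x = g * x * g⁻¹ :=
    ⟨_, fun _ => rfl⟩
  have hg : ∀ a b, φ π (g a) = g b ↔ π a = b := fun a b => by
    rw [hφ, conj_apply_apply, g.injective.eq_iff]
  have hα : ∀ a b, alphaPerm (φ π) (g a) (g b) = φ (alphaPerm π a b) := fun a b => by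
    rw [hφ, hφ, alphaPerm_conj]
  have hs : ∀ a b, Equiv.swap (g a) (g b) = φ (Equiv.swap a b) := fun a b => by
    rw [hφ, Equiv.swap_apply_apply]
  have hmul : ∀ x y, φ x * φ y = φ (x * y) := fun x y => by
    simp only [hφ, mul_assoc, inv_mul_cancel_left]
  rw [← hφ, ← hφ]
  unfold piDag
  repeat' refine ite_eq_map_ite (by simp only [hg, ne_eq]) ?_ ?_
  all_goals simp only [hα, hs, hmul]

theorem swap_conj_apply_left {n : ℕ} {ρ : Equiv.Perm (Fin n)} {a b c : Fin n}
    (hb : ρ b = c) (hac : a ≠ c) (hbc : b ≠ c) :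
    (Equiv.swap a b * ρ * (Equiv.swap a b)⁻¹) a = c := by
  simp [hb, Equiv.swap_apply_of_ne_of_ne hac.symm hbc.symm]

theorem swap_conj_apply_right {n : ℕ} {ρ : Equiv.Perm (Fin n)} {a b e : Fin n}
    (ha : ρ a = e) (hae : a ≠ e) (hbe : b ≠ e) :
    (Equiv.swap a b * ρ * (Equiv.swap a b)⁻¹) b = e := by
  simp [ha, Equiv.swap_apply_of_ne_of_ne hae.symm hbe.symm]

theorem mul_swap_mul_swap_eq_conj {n : ℕ} {ρ : Equiv.Perm (Fin n)} {a b c e : Fin n}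
    (hc : ρ c = b) (he : ρ e = a)
    (hac : a ≠ c) (hae : a ≠ e) (hbc : b ≠ c) (hbe : b ≠ e) :
    ρ * Equiv.swap a b * Equiv.swap c e = Equiv.swap a b * ρ * (Equiv.swap a b)⁻¹ := by
  have hd : Equiv.Perm.Disjoint (Equiv.swap a b) (Equiv.swap c e) := by
    intro x
    by_cases h : x = c ∨ x = e
    · left; rcases h with rfl | rfl <;> exact Equiv.swap_apply_of_ne_of_ne (by tauto) (by tauto)
    · right; exact Equiv.swap_apply_of_ne_of_ne (by tauto) (by tauto)
  rw [mul_assoc, hd.commute.eq, ← mul_assoc, mul_swap_eq ρ c e, hc, he, Equiv.swap_inv,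
    Equiv.swap_comm b a]

/-- If `ρ` matches `a` with `e` and `b` with `c`, then `ρ τ_{a,b} τ_{c,e}` exchanges the partners:
it is the conjugate of `ρ` by `τ_{a,b}`, and matches `a` with `c` and `b` with `e`. -/
theorem mul_swap_mul_swap_mem {n : ℕ} {ρ : Equiv.Perm (Fin n)} (hρ : ρ ∈ fpfInvolutions n)
    {a b c e : Fin n} (hc : ρ c = b) (he : ρ e = a)
    (hac : a ≠ c) (hae : a ≠ e) (hbc : b ≠ c) (hbe : b ≠ e) :
    ρ * Equiv.swap a b * Equiv.swap c e ∈ fpfInvolutions n ∧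
    (ρ * Equiv.swap a b * Equiv.swap c e) a = c ∧ (ρ * Equiv.swap a b * Equiv.swap c e) b = e := by
  have hb : ρ b = c := by rw [← hc]; exact (mem_fpf.1 hρ).1 c
  have ha : ρ a = e := by rw [← he]; exact (mem_fpf.1 hρ).1 e
  rw [mul_swap_mul_swap_eq_conj hc he hac hae hbc hbe]
  exact ⟨conj_mem_fpf hρ _, swap_conj_apply_left hb hac hbc, swap_conj_apply_right ha hae hbe⟩

theorem card_eq_four_iff {n : ℕ} {i j k l : Fin n} :
    ({i, j, k, l} : Finset (Fin n)).card = 4 ↔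
      i ≠ j ∧ i ≠ k ∧ i ≠ l ∧ j ≠ k ∧ j ≠ l ∧ k ≠ l := by
  constructor
  · intro h
    have h3 : ∀ a b c : Fin n, ({a, b, c} : Finset (Fin n)).card ≠ 4 := fun a b c e => by
      have := Finset.card_le_three (a := a) (b := b) (c := c)
      omega
    refine ⟨?_, ?_, ?_, ?_, ?_, ?_⟩ <;> rintro rfl
    · exact h3 i k l (by simpa using h)
    · exact h3 j i l (by simpa using h)
    · exact h3 j k i (by simpa using h)
    · exact h3 i j l (by simpa using h)
    · exact h3 i k j (by simpa using h)
    · exact h3 i j k (by simpa using h)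
  · rintro ⟨hij, hik, hil, hjk, hjl, hkl⟩
    rw [Finset.card_insert_of_notMem (by simp [*]), Finset.card_insert_of_notMem (by simp [*]),
      Finset.card_pair hkl]

theorem piDag_mem {n : ℕ} {π : Equiv.Perm (Fin n)} (hπ : π ∈ fpfInvolutions n) {i j k l : Fin n}
    (h : ({i, j, k, l} : Finset (Fin n)).card = 4) :
    piDag π i j k l ∈ fpfInvolutions n ∧ piDag π i j k l i = k ∧ piDag π i j k l j = l := by
  obtain ⟨hij, hik, hil, hjk, hjl, hkl⟩ := card_eq_four_iff.1 h
  have hfl : ∀ {a b}, π a = b → π b = a := fun {a b} h => by rw [← h, (mem_fpf.1 hπ).1]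
  have hne : ∀ {a b c}, π a = b → a ≠ c → b ≠ π c := fun {a b c} h hac e =>
    hac (π.injective (h.trans e))
  -- a pair matched by `π` survives switching two points outside it
  have hkeep : ∀ {a b c e}, π a = b → a ≠ c → a ≠ e → b ≠ c → b ≠ e → switch π c e a = b :=
    fun {a b c e} h hac hae hbc hbe => by
      rw [switch_apply_of_ne π hac hae (hne (hfl h) hbc) (hne (hfl h) hbe), h]
  have hcross : ∀ {ρ : Equiv.Perm (Fin n)}, ρ ∈ fpfInvolutions n → ρ k = j → ρ l = i →
      ρ * Equiv.swap i j * Equiv.swap k l ∈ fpfInvolutions n ∧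
      (ρ * Equiv.swap i j * Equiv.swap k l) i = k ∧ (ρ * Equiv.swap i j * Equiv.swap k l) j = l :=
    fun hρ h1 h2 => mul_swap_mul_swap_mem hρ h1 h2 hik hil hjk hjl
  have hpar : ∀ {ρ : Equiv.Perm (Fin n)}, ρ ∈ fpfInvolutions n → ρ k = l → ρ j = i →
      ρ * Equiv.swap i l * Equiv.swap j k ∈ fpfInvolutions n ∧
      (ρ * Equiv.swap i l * Equiv.swap j k) i = k ∧
      (ρ * Equiv.swap i l * Equiv.swap j k) j = l := by
    intro ρ hρ h1 h2
    rw [Equiv.swap_comm j k]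
    obtain ⟨h3, h4, h5⟩ := mul_swap_mul_swap_mem hρ h1 h2 hik hij hkl.symm hjl.symm
    refine ⟨h3, h4, ?_⟩
    have := (mem_fpf.1 h3).1 l
    rwa [h5] at this
  unfold piDag
  simp only [show ∀ a b, π * alphaPerm π a b = switch π a b from fun _ _ => rfl]
  let P : Equiv.Perm (Fin n) → Prop := fun ρ => ρ ∈ fpfInvolutions n ∧ ρ i = k ∧ ρ j = l
  refine iteInduction (motive := P) (fun h1 => ?_) fun h1 => ?_
  · exact ⟨switch_mem_fpf hπ _ _, hkeep h1.1 hij hil hjk.symm hkl, switch_apply_left hπ hjl⟩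
  refine iteInduction (motive := P) (fun h2 => ?_) fun h2 => ?_
  · exact ⟨switch_mem_fpf hπ _ _, switch_apply_left hπ hik,
      hkeep h2.2 hij.symm hjk hil.symm hkl.symm⟩
  refine iteInduction (motive := P) (fun h3 => ?_) fun h3 => ?_
  · exact hcross (switch_mem_fpf hπ _ _) (switch_apply_right hπ hjk)
      (hkeep (hfl h3.1) hjl.symm hkl.symm hij hik)
  refine iteInduction (motive := P) (fun h4 => ?_) fun h4 => ?_
  · exact hcross (switch_mem_fpf hπ _ _) (hkeep (hfl h4.2) hik.symm hkl hij.symm hjl)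
      (switch_apply_right hπ hil)
  refine iteInduction (motive := P) (fun h5 => ?_) fun h5 => ?_
  · exact hpar (switch_mem_fpf hπ _ _) (switch_apply_left hπ hkl) (hkeep (hfl h5.1) hjk hjl hik hil)
  refine iteInduction (motive := P) (fun h6 => ?_) fun h6 => ?_
  · exact hpar (switch_mem_fpf hπ _ _) (hkeep h6.2 hik.symm hjk.symm hil.symm hjl.symm)
      (switch_apply_right hπ hij)
  refine iteInduction (motive := P) (fun h7 => ?_) fun h7 => ?_
  · exact ⟨hπ, h7⟩
  refine iteInduction (motive := P) (fun h8 => ?_) fun h8 => ?_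
  · exact hpar hπ h8.2 (hfl h8.1)
  refine iteInduction (motive := P) (fun h9 => ?_) fun h9 => ?_
  · exact hcross hπ (hfl h9.2) (hfl h9.1)
  · have e1 : π i ≠ k := fun e => (em (π j = l)).elim (fun h => h7 ⟨e, h⟩) fun h => h1 ⟨e, h⟩
    have e2 : π j ≠ l := fun e => (em (π i = k)).elim (fun h => h7 ⟨h, e⟩) fun h => h2 ⟨h, e⟩
    have e3 : π i ≠ l := fun e => (em (π j = k)).elim (fun h => h9 ⟨e, h⟩) fun h => h3 ⟨e, h⟩
    have e4 : π j ≠ k := fun e => (em (π i = l)).elim (fun h => h9 ⟨h, e⟩) fun h => h4 ⟨h, e⟩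
    have e5 : π i ≠ j := fun e => (em (π k = l)).elim (fun h => h8 ⟨e, h⟩) fun h => h5 ⟨e, h⟩
    have e6 : π k ≠ l := fun e => (em (π i = j)).elim (fun h => h8 ⟨h, e⟩) fun h => h6 ⟨h, e⟩
    have hj : switch π i k j = π j := switch_apply_of_ne π hij.symm hjk (Ne.symm e5)
      (fun e => e4 (hfl e.symm))
    have hl : switch π i k l = π l := switch_apply_of_ne π hil.symm hkl.symm (Ne.symm e3)
      (Ne.symm e6)
    have heq : switch π i k * alphaPerm π j l = switch (switch π i k) j l := by
      change switch π i k * (Equiv.swap j (π l) * Equiv.swap l (π j)) =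
        switch π i k * (Equiv.swap j (switch π i k l) * Equiv.swap l (switch π i k j))
      rw [hj, hl]
    have hm := switch_mem_fpf hπ i k
    rw [heq]
    refine ⟨switch_mem_fpf hm _ _, ?_, switch_apply_left hm hjl⟩
    rw [switch_apply_of_ne _ hij hil, switch_apply_left hπ hik]
    · rw [hj]; exact fun e => e5 (hfl e.symm)
    · rw [hl]; exact fun e => e3 (hfl e.symm)

theorem piDag_apply_of_notMem {n : ℕ} (π : Equiv.Perm (Fin n)) {i j k l m : Fin n}
    (h : m ∉ indexSet π i j k l) : piDag π i j k l m = π m := by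
  simp only [indexSet, Finset.mem_insert, Finset.mem_singleton, not_or] at h
  obtain ⟨h1, h2, h3, h4, h5, h6, h7, h8⟩ := h
  have hs : ∀ {a b}, m ≠ a → m ≠ b → Equiv.swap a b m = m := Equiv.swap_apply_of_ne_of_ne
  unfold piDag alphaPerm
  repeat'
    refine iteInduction (motive := fun ρ : Equiv.Perm (Fin n) => ρ m = π m) (fun _ => ?_)
      fun _ => ?_
  all_goals
    simp only [Equiv.Perm.mul_apply, hs h1 h2, hs h3 h4, hs h1 h4, hs h2 h3, hs h1 h6, hs h1 h7,
      hs h1 h8, hs h2 h5, hs h2 h7, hs h2 h8, hs h3 h5, hs h3 h6, hs h3 h8, hs h4 h5, hs h4 h6,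
      hs h4 h7]

/-! ### Symmetry counts for fixed-point-free involutions -/

theorem cycleType_eq_replicate_two {α : Type*} [Fintype α] [DecidableEq α] {σ : Equiv.Perm α}
    (h : ∀ x, σ (σ x) = x) (h' : ∀ x, σ x ≠ x) :
    σ.cycleType = Multiset.replicate (Fintype.card α / 2) 2 := by
  have h1 : ∀ c ∈ σ.cycleType, c = 2 := Equiv.Perm.pow_prime_eq_one_iff.1 (by
    ext x; simp [pow_two, h])
  have h2 := σ.sum_cycleType
  have h3 : σ.support = Finset.univ := by ext x; simp [h']
  rw [Multiset.eq_replicate_of_mem h1] at h2 ⊢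
  simp only [Multiset.sum_replicate, smul_eq_mul, h3, Finset.card_univ] at h2
  rw [← h2, Nat.mul_div_cancel _ two_pos]

/-- Two fixed-point-free involutions that agree on an invariant set `Q` are conjugate by a
permutation fixing `Q` pointwise: outside `Q` they have the same cycle type. -/
theorem exists_perm_conj_eq {α : Type*} [Fintype α] [DecidableEq α] {σ τ : Equiv.Perm α}
    (hσ : ∀ x, σ (σ x) = x) (hσ' : ∀ x, σ x ≠ x) (hτ : ∀ x, τ (τ x) = x) (hτ' : ∀ x, τ x ≠ x)
    (Q : Finset α) (hQ : ∀ x ∈ Q, σ x ∈ Q ∧ τ x = σ x) :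
    ∃ g : Equiv.Perm α, (∀ x ∈ Q, g x = x) ∧ g * σ * g⁻¹ = τ := by
  have hs : ∀ x, σ x ∉ Q ↔ x ∉ Q := fun x => not_congr
    ⟨fun h => by simpa [hσ] using (hQ _ h).1, fun h => (hQ _ h).1⟩
  have ht : ∀ x, τ x ∉ Q ↔ x ∉ Q := fun x => not_congr
    ⟨fun h => by have := (hQ _ h); rw [← this.2, hτ] at this; exact this.1,
      fun h => by rw [(hQ _ h).2]; exact (hQ _ h).1⟩
  obtain ⟨c, hc⟩ := isConj_iff.1 (Equiv.Perm.isConj_of_cycleType_eq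
    (σ := σ.subtypePerm (p := (· ∉ Q)) hs) (τ := τ.subtypePerm (p := (· ∉ Q)) ht)
    (by rw [cycleType_eq_replicate_two, cycleType_eq_replicate_two] <;>
      simp [Subtype.ext_iff, hσ, hσ', hτ, hτ']))
  rw [mul_inv_eq_iff_eq_mul] at hc
  refine ⟨Equiv.Perm.ofSubtype c, fun x hx =>
    Equiv.Perm.ofSubtype_apply_of_not_mem (p := (· ∉ Q)) _ (by simpa),
    mul_inv_eq_iff_eq_mul.2 (Equiv.ext fun x => ?_)⟩
  by_cases hx : x ∈ Q
  · simp only [Equiv.Perm.mul_apply]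
    rw [Equiv.Perm.ofSubtype_apply_of_not_mem (p := (· ∉ Q)) _ (not_not.2 hx),
      Equiv.Perm.ofSubtype_apply_of_not_mem (p := (· ∉ Q)) _ (not_not.2 (hQ x hx).1), (hQ x hx).2]
  · have := congrArg Subtype.val (DFunLike.congr_fun hc ⟨x, hx⟩)
    simp only [Equiv.Perm.mul_apply, Equiv.Perm.subtypePerm_apply] at this ⊢
    rw [Equiv.Perm.ofSubtype_apply_of_mem (p := (· ∉ Q)) _ hx,
      Equiv.Perm.ofSubtype_apply_of_mem (p := (· ∉ Q)) _ ((hs x).2 hx), this]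

/-- The elements of `Π_n` that send `i` to `k` and `j` to `l`. -/
def constrained {n : ℕ} (i j k l : Fin n) : Finset (Equiv.Perm (Fin n)) :=
  (fpfInvolutions n).filter fun σ => σ i = k ∧ σ j = l

theorem mem_constrained {n : ℕ} {i j k l : Fin n} {σ : Equiv.Perm (Fin n)} :
    σ ∈ constrained i j k l ↔ σ ∈ fpfInvolutions n ∧ σ i = k ∧ σ j = l := Finset.mem_filter

/-- Conjugation by `g` injects the involutions with property `p` into those with property `q`. All
counts by symmetry below are instances of this. -/
theorem card_filter_conj_le {n : ℕ} (p q : Equiv.Perm (Fin n) → Prop) [DecidablePred p]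
    [DecidablePred q] (g : Equiv.Perm (Fin n)) (h : ∀ π, p π → q (g * π * g⁻¹)) :
    ((fpfInvolutions n).filter p).card ≤ ((fpfInvolutions n).filter q).card := by
  refine Finset.card_le_card_of_injOn (fun π => g * π * g⁻¹) (fun π hπ => ?_) fun a _ b _ hab => ?_
  · simp only [Finset.coe_filter, Set.mem_ofPred_eq] at hπ ⊢
    exact ⟨conj_mem_fpf hπ.1 g, h π hπ.2⟩
  · simpa using hab

/-- All the fibres of `π ↦ π†` have the same size: by symmetry it suffices to compare two of
them. -/
theorem card_fiber_le {n : ℕ} {i j k l : Fin n} {σ τ : Equiv.Perm (Fin n)}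
    (hσ : σ ∈ constrained i j k l) (hτ : τ ∈ constrained i j k l) :
    ((fpfInvolutions n).filter fun π => piDag π i j k l = σ).card ≤
    ((fpfInvolutions n).filter fun π => piDag π i j k l = τ).card := by
  rw [mem_constrained] at hσ hτ
  obtain ⟨hσ, h1, h2⟩ := hσ
  obtain ⟨hτ, h3, h4⟩ := hτ
  rw [mem_fpf] at hσ hτ
  obtain ⟨g, hg, hg'⟩ := exists_perm_conj_eq hσ.1 hσ.2 hτ.1 hτ.2 {i, j, k, l} (by
    have h1' := hσ.1 i
    have h2' := hσ.1 j
    have h3' := hτ.1 i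
    have h4' := hτ.1 j
    simp_all)
  refine card_filter_conj_le _ _ g fun π hπ => ?_
  have := piDag_conj g π i j k l
  rw [hg i (by simp), hg j (by simp), hg k (by simp), hg l (by simp)] at this
  rw [this, hπ, hg']

/-- If `π` is uniform on `Π_n`, then `π†` is uniform on `constrained i j k l`, stated without
divisions. -/
theorem sum_comp_piDag {n : ℕ} {i j k l : Fin n} (hq : ({i, j, k, l} : Finset (Fin n)).card = 4)
    (h : Equiv.Perm (Fin n) → ℝ) :
    ((constrained i j k l).card : ℝ) * ∑ π ∈ fpfInvolutions n, h (piDag π i j k l) =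
      (fpfInvolutions n).card * ∑ σ ∈ constrained i j k l, h σ := by
  have hmaps : ∀ π ∈ fpfInvolutions n, piDag π i j k l ∈ constrained i j k l :=
    fun π hπ => mem_constrained.2 (piDag_mem hπ hq)
  have hconst : ∃ N : ℕ, ∀ σ ∈ constrained i j k l,
      ((fpfInvolutions n).filter fun π => piDag π i j k l = σ).card = N := by
    by_cases hT : (constrained i j k l).Nonempty
    · obtain ⟨τ, hτ⟩ := hT
      exact ⟨_, fun σ hσ => le_antisymm (card_fiber_le hσ hτ) (card_fiber_le hτ hσ)⟩
    · exact ⟨0, fun σ hσ => (hT ⟨σ, hσ⟩).elim⟩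
  obtain ⟨N, hN⟩ := hconst
  have key : ∀ f : Equiv.Perm (Fin n) → ℝ, ∑ π ∈ fpfInvolutions n, f (piDag π i j k l) =
      N * ∑ σ ∈ constrained i j k l, f σ := fun f => by
    rw [← Finset.sum_fiberwise_of_maps_to hmaps, Finset.mul_sum]
    refine Finset.sum_congr rfl fun σ hσ => ?_
    rw [Finset.sum_congr rfl (g := fun _ => f σ) fun π hπ => by rw [(Finset.mem_filter.1 hπ).2],
      Finset.sum_const, hN σ hσ, nsmul_eq_mul]
  have h1 := key fun _ => 1
  simp only [Finset.sum_const, nsmul_eq_mul, mul_one] at h1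
  rw [key, h1]; ring

theorem card_constrained_le {n : ℕ} {i j k l i' j' k' l' : Fin n}
    (h : ({i, j, k, l} : Finset (Fin n)).card = 4)
    (h' : ({i', j', k', l'} : Finset (Fin n)).card = 4) :
    (constrained i j k l).card ≤ (constrained i' j' k' l').card := by
  have hinj : ∀ {i j k l : Fin n}, ({i, j, k, l} : Finset (Fin n)).card = 4 →
      Function.Injective ![i, j, k, l] := fun {i j k l} h => by
    obtain ⟨hij, hik, hil, hjk, hjl, hkl⟩ := card_eq_four_iff.1 h
    intro a b
    fin_cases a <;> fin_cases b <;> simp [hij, hik, hil, hjk, hjl, hkl, hij.symm, hik.symm,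
      hil.symm, hjk.symm, hjl.symm, hkl.symm]
  obtain ⟨g, hg⟩ := MulAction.isMultiplyPretransitive_iff.1
    (Equiv.Perm.isMultiplyPretransitive (Fin n) 4) ⟨_, hinj h⟩ ⟨_, hinj h'⟩
  have e0 : g i = i' := DFunLike.congr_fun hg 0
  have e1 : g j = j' := DFunLike.congr_fun hg 1
  have e2 : g k = k' := DFunLike.congr_fun hg 2
  have e3 : g l = l' := DFunLike.congr_fun hg 3
  refine card_filter_conj_le _ _ g fun π hπ => ?_
  rw [← e0, ← e1, ← e2, ← e3, conj_apply_apply, conj_apply_apply, hπ.1, hπ.2]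
  exact ⟨rfl, rfl⟩

/-- For `π` uniform on `Π_n`, the partner of `i` is uniform on the other `n - 1` points. -/
theorem card_filter_apply_eq {n : ℕ} {i m : Fin n} (h : i ≠ m) :
    ((n : ℝ) - 1) * ((fpfInvolutions n).filter fun π => π i = m).card =
      (fpfInvolutions n).card := by
  have h1 : ∀ {m m' : Fin n}, i ≠ m → i ≠ m' →
      ((fpfInvolutions n).filter fun π => π i = m).card ≤
      ((fpfInvolutions n).filter fun π => π i = m').card := fun {m m'} hm hm' => by
    refine card_filter_conj_le _ _ (Equiv.swap m m') fun π hπ => ?_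
    have := conj_apply_apply (Equiv.swap m m') π i
    rwa [Equiv.swap_apply_of_ne_of_ne hm hm', hπ, Equiv.swap_apply_left] at this
  rw [Finset.card_eq_sum_card_fiberwise (f := fun π => π i) (t := Finset.univ.erase i)
    (s := fpfInvolutions n) (fun π hπ => by simpa using (mem_fpf.1 hπ).2 i)]
  rw [Finset.sum_congr rfl fun m' hm' => le_antisymm (h1 (Finset.ne_of_mem_erase hm').symm h)
    (h1 h (Finset.ne_of_mem_erase hm').symm)]
  have : 1 ≤ n := by have := i.2; omega
  simp [Finset.card_erase_of_mem, this]

theorem card_constrained_mul_le {n : ℕ} {i j k l : Fin n}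
    (hq : ({i, j, k, l} : Finset (Fin n)).card = 4) :
    ((n : ℝ) - 1) * (n - 3) * (constrained i j k l).card ≤ (fpfInvolutions n).card := by
  obtain ⟨hij, hik, hil, hjk, hjl, hkl⟩ := card_eq_four_iff.1 hq
  rw [← card_filter_apply_eq hik, mul_assoc]
  have hn : 4 ≤ n := by
    have := Finset.card_le_univ ({i, j, k, l} : Finset (Fin n)); simpa [hq] using this
  refine mul_le_mul_of_nonneg_left ?_ (by
    have : (4:ℝ) ≤ n := by exact_mod_cast hn
    linarith)
  have h1 : ({i, j, k} : Finset (Fin n))ᶜ.card = n - 3 := by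
    rw [Finset.card_compl, Fintype.card_fin, Finset.card_eq_three.2 ⟨i, j, k, hij, hik, hjk, rfl⟩]
  have h2 : ∑ l' ∈ ({i, j, k} : Finset (Fin n))ᶜ, (constrained i j k l').card ≤
      ((fpfInvolutions n).filter fun π => π i = k).card := by
    rw [← Finset.card_biUnion]
    · refine Finset.card_le_card fun π hπ => ?_
      simp only [Finset.mem_biUnion, mem_constrained] at hπ
      obtain ⟨a, -, h1, h2, -⟩ := hπ
      exact Finset.mem_filter.2 ⟨h1, h2⟩
    · intro a _ b _ hab
      rw [Function.onFun, Finset.disjoint_left]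
      intro π h1 h2
      exact hab ((mem_constrained.1 h1).2.2.symm.trans (mem_constrained.1 h2).2.2)
  have h3 : (n - 3) * (constrained i j k l).card ≤
      ((fpfInvolutions n).filter fun π => π i = k).card := by
    refine le_trans ?_ h2
    rw [← h1, ← smul_eq_mul, ← Finset.sum_const]
    refine Finset.sum_le_sum fun l' hl' => card_constrained_le hq ?_
    simp only [Finset.mem_compl, Finset.mem_insert, Finset.mem_singleton, not_or] at hl'
    rw [card_eq_four_iff]
    exact ⟨hij, hik, Ne.symm hl'.1, hjk, Ne.symm hl'.2.1, Ne.symm hl'.2.2⟩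
  have h4 : ((n - 3 : ℕ) : ℝ) = n - 3 := by push_cast [show 3 ≤ n by omega]; ring
  rw [← h4]
  exact_mod_cast h3

/-- For a point `a` of the quadruple, an ordered pair `(π a, π† (π a))` of points outside the
quadruple takes each of its `(n - 4)(n - 5)` values equally often. -/
theorem card_pair_mul_le {n : ℕ} {i j k l m m' a : Fin n}
    (hq : ({i, j, k, l} : Finset (Fin n)).card = 4) (ha : a ∈ ({i, j, k, l} : Finset (Fin n)))
    (hm : m ∉ ({i, j, k, l} : Finset (Fin n))) (hm' : m' ∉ ({i, j, k, l} : Finset (Fin n)))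
    (hne : m ≠ m') (hn : 6 ≤ n) :
    ((fpfInvolutions n).filter fun π => π a = m ∧ piDag π i j k l m = m').card *
      (((n : ℝ) - 4) * (n - 5)) ≤ (fpfInvolutions n).card := by
  set Q : Finset (Fin n) := {i, j, k, l} with hQ
  have hle : ∀ p ∈ Qᶜ.offDiag,
      ((fpfInvolutions n).filter fun π => π a = m ∧ piDag π i j k l m = m').card ≤
      ((fpfInvolutions n).filter fun π => π a = p.1 ∧ piDag π i j k l p.1 = p.2).card := by
    rintro ⟨b, b'⟩ hb
    simp only [Finset.mem_offDiag, Finset.mem_compl] at hb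
    obtain ⟨hb, hb', hbb⟩ := hb
    have hfix : ∀ {x y c}, x ∉ Q → y ∉ Q → c ∈ Q → Equiv.swap x y c = c :=
      fun {x y c} hx hy hc =>
        Equiv.swap_apply_of_ne_of_ne (fun e => hx (e ▸ hc)) fun e => hy (e ▸ hc)
    -- `g` fixes the quadruple and moves the pair `(m, m')` to `(b, b')`, one point at a time.
    set g₁ := Equiv.swap m b
    have hg₁ : g₁ m = b := Equiv.swap_apply_left _ _
    have hg₁Q : g₁ m' ∉ Q := fun h => by
      have := hfix hm hb h
      rw [Equiv.swap_apply_self] at this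
      exact hm' (this ▸ h)
    set g := Equiv.swap (g₁ m') b' * g₁
    have hgQ : ∀ c ∈ Q, g c = c := fun c hc => by
      simp only [g, Equiv.Perm.mul_apply, g₁, hfix hm hb hc]
      exact hfix hg₁Q hb' hc
    have hgm : g m = b := by
      simp only [g, Equiv.Perm.mul_apply, hg₁]
      exact Equiv.swap_apply_of_ne_of_ne (fun e => hne (g₁.injective (hg₁.trans e))) hbb
    have hgm' : g m' = b' := by simp [g]
    refine card_filter_conj_le _ _ g fun π hπ => ?_
    have h1 := conj_apply_apply g π a
    have h2 := piDag_conj g π i j k l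
    have h3 := conj_apply_apply g (piDag π i j k l) m
    rw [hgQ a ha, hπ.1, hgm] at h1
    rw [hgQ i (by simp [hQ]), hgQ j (by simp [hQ]), hgQ k (by simp [hQ]),
      hgQ l (by simp [hQ])] at h2
    rw [← h2, hπ.2, hgm, hgm'] at h3
    exact ⟨h1, h3⟩
  have hsum : ∑ p ∈ Qᶜ.offDiag,
      ((fpfInvolutions n).filter fun π => π a = p.1 ∧ piDag π i j k l p.1 = p.2).card ≤
      (fpfInvolutions n).card := by
    rw [← Finset.card_biUnion]
    · refine Finset.card_le_card fun π hπ => ?_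
      simp only [Finset.mem_biUnion, Finset.mem_filter] at hπ
      obtain ⟨-, -, h, -⟩ := hπ
      exact h
    · intro p _ r _ hpr
      rw [Function.onFun, Finset.disjoint_left]
      intro π h1 h2
      have h1 := (Finset.mem_filter.1 h1).2
      have h2 := (Finset.mem_filter.1 h2).2
      have e1 : p.1 = r.1 := h1.1.symm.trans h2.1
      exact hpr (Prod.ext e1 (by rw [← h1.2, ← h2.2, e1]))
  have hcard : Qᶜ.offDiag.card = (n - 4) * (n - 5) := by
    rw [Finset.offDiag_card, Finset.card_compl, hq, Fintype.card_fin, ← Nat.mul_sub_one,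
      Nat.sub_sub]
  have h4 : ((n - 4 : ℕ) : ℝ) = n - 4 := by push_cast [show 4 ≤ n by omega]; ring
  have h5 : ((n - 5 : ℕ) : ℝ) = n - 5 := by push_cast [show 5 ≤ n by omega]; ring
  have := (Finset.card_nsmul_le_sum _ _ _ hle).trans hsum
  rw [hcard, smul_eq_mul, mul_comm] at this
  rw [← h4, ← h5]
  exact_mod_cast this

/-! ### The Stein identity and the square-biased pair -/

theorem permSum_sub_permSum_switch {n : ℕ} {d : Fin n → Fin n → ℝ} (hd : IsStandardArray d)
    {π : Equiv.Perm (Fin n)} (hπ : π ∈ fpfInvolutions n) {i j : Fin n} (hij : i ≠ j) :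
    permSum d π - permSum d (switch π i j) =
      2 * (d i (π i) + d j (π j) - (d i j + d (π i) (π j))) := by
  have hinv := (mem_fpf.1 hπ).1
  have hfix := (mem_fpf.1 hπ).2
  by_cases h : π i = j
  · have h' : π j = i := by rw [← h, hinv]
    rw [switch_eq_self hπ h, h, h', hd.symm j i]; ring
  have h1 : π i ≠ π j := fun e => hij (π.injective e)
  have h2 : i ≠ π j := fun e => h (by rw [e, hinv])
  rw [permSum, permSum, ← Finset.sum_sub_distrib,
    ← Finset.sum_subset (Finset.subset_univ ({i, j, π i, π j} : Finset (Fin n)))]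
  · rw [Finset.sum_insert (by simp [hij, (hfix i).symm, h2]),
      Finset.sum_insert (by simp [Ne.symm h, (hfix j).symm]), Finset.sum_pair h1,
      switch_apply_left hπ hij, switch_apply_right hπ hij, switch_apply_apply hπ hij]
    have h3 : switch π i j (π j) = π i := by
      rw [← switch_apply_apply hπ hij, (mem_fpf.1 (switch_mem_fpf hπ i j)).1]
    rw [h3, hinv, hinv, hd.symm (π i) i, hd.symm (π j) j, hd.symm j i, hd.symm (π j) (π i)]
    ring
  · intro m _ hm
    simp only [Finset.mem_insert, Finset.mem_singleton, not_or] at hm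
    rw [switch_apply_of_ne π hm.1 hm.2.1 hm.2.2.1 hm.2.2.2, sub_self]

theorem sum_permSum_sub_permSum_switch {n : ℕ} {d : Fin n → Fin n → ℝ} (hd : IsStandardArray d)
    {π : Equiv.Perm (Fin n)} (hπ : π ∈ fpfInvolutions n) :
    ∑ i, ∑ j, (permSum d π - permSum d (switch π i j)) = 4 * ((n : ℝ) - 1) * permSum d π := by
  have h1 : ∀ i j, permSum d π - permSum d (switch π i j) =
      2 * (d i (π i) + d j (π j) - (d i j + d (π i) (π j))) -
        if j = i then 4 * d i (π i) else 0 := by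
    intro i j
    by_cases hij : j = i
    · subst hij
      rw [switch_self, if_pos rfl, hd.diag, hd.diag]; ring
    · rw [permSum_sub_permSum_switch hd hπ (Ne.symm hij), if_neg hij, sub_zero]
  have h2 : ∀ i, ∑ j, d i (π j) = 0 := fun i => by
    rw [Equiv.sum_comp π (d i), hd.row_sum]
  simp only [h1, Finset.sum_sub_distrib, ← Finset.mul_sum, Finset.sum_add_distrib, h2, hd.row_sum,
    Finset.sum_ite_eq', Finset.mem_univ, if_true, Finset.sum_const, Finset.card_univ,
    Fintype.card_fin, nsmul_eq_mul]
  simp only [permSum]; ring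

/-- The Stein identity: the reversal `(π, i, j) ↦ (switch π i j, i, π i)` makes the two halves of
the left-hand side equal, and the increments of `W` sum to a multiple of `W`. -/
theorem sum_permSum_sub_mul_sub {n : ℕ} {d : Fin n → Fin n → ℝ} (hd : IsStandardArray d)
    (f : ℝ → ℝ) :
    ∑ π ∈ fpfInvolutions n, ∑ i, ∑ j, (permSum d π - permSum d (switch π i j)) *
      (f (permSum d π) - f (permSum d (switch π i j))) =
    8 * ((n : ℝ) - 1) * ∑ π ∈ fpfInvolutions n, permSum d π * f (permSum d π) := by
  set φ : Equiv.Perm (Fin n) × Fin n × Fin n → ℝ := fun x =>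
    (permSum d x.1 - permSum d (switch x.1 x.2.1 x.2.2)) * f (permSum d x.1) with hφ
  set ψ : Equiv.Perm (Fin n) × Fin n × Fin n → ℝ := fun x =>
    (permSum d x.1 - permSum d (switch x.1 x.2.1 x.2.2)) *
      f (permSum d (switch x.1 x.2.1 x.2.2)) with hψ
  have hoff : ∀ F : Equiv.Perm (Fin n) × Fin n × Fin n → ℝ, (∀ π i, F (π, i, i) = 0) →
      ∑ π ∈ fpfInvolutions n, ∑ i, ∑ j, F (π, i, j) =
      ∑ x ∈ fpfInvolutions n ×ˢ Finset.univ.offDiag, F x := fun F hF => by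
    rw [Finset.sum_product]
    refine Finset.sum_congr rfl fun π _ => ?_
    rw [← Finset.sum_product', Finset.univ_product_univ]
    refine (Finset.sum_subset (Finset.subset_univ _) fun p _ hp => ?_).symm
    obtain ⟨a, b⟩ := p
    simp only [Finset.mem_offDiag, Finset.mem_univ, true_and, not_not] at hp
    rw [hp]; exact hF π b
  have hrev : ∑ x ∈ fpfInvolutions n ×ˢ Finset.univ.offDiag, ψ x =
      ∑ x ∈ fpfInvolutions n ×ˢ Finset.univ.offDiag, -φ x := by
    refine Finset.sum_nbij' (fun x => (switch x.1 x.2.1 x.2.2, x.2.1, x.1 x.2.1))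
      (fun x => (switch x.1 x.2.1 x.2.2, x.2.1, x.1 x.2.1)) ?_ ?_ ?_ ?_ ?_
    all_goals
      rintro ⟨π, i, j⟩ hx
      simp only [Finset.mem_product, Finset.mem_offDiag, Finset.mem_univ, true_and] at hx ⊢
      obtain ⟨hπ, hij⟩ := hx
    · exact ⟨switch_mem_fpf hπ _ _, ((mem_fpf.1 hπ).2 i).symm⟩
    · exact ⟨switch_mem_fpf hπ _ _, ((mem_fpf.1 hπ).2 i).symm⟩
    · rw [switch_switch hπ hij, switch_apply_left hπ hij]
    · rw [switch_switch hπ hij, switch_apply_left hπ hij]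
    · simp only [hφ, hψ, switch_switch hπ hij]; ring
  have hsplit : ∀ π i j, (permSum d π - permSum d (switch π i j)) *
      (f (permSum d π) - f (permSum d (switch π i j))) = φ (π, i, j) - ψ (π, i, j) :=
    fun π i j => mul_sub _ _ _
  simp only [hsplit, Finset.sum_sub_distrib]
  rw [hoff ψ (fun π i => by simp [hψ, switch_self]), hrev, Finset.sum_neg_distrib,
    ← hoff φ (fun π i => by simp [hφ, switch_self]), sub_neg_eq_add, ← two_mul, Finset.mul_sum,
    Finset.mul_sum]
  refine Finset.sum_congr rfl fun π hπ => ?_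
  simp only [hφ, ← Finset.sum_mul, sum_permSum_sub_permSum_switch hd hπ]
  ring

theorem quadWeight_eq {n : ℕ} {d : Fin n → Fin n → ℝ} (hd : IsStandardArray d)
    {i j k l : Fin n} (hq : ({i, j, k, l} : Finset (Fin n)).card = 4) {σ : Equiv.Perm (Fin n)}
    (hσ : σ ∈ constrained i j k l) :
    4 * quadWeight d i j k l = (permSum d σ - permSum d (switch σ i j)) ^ 2 := by
  obtain ⟨hσ, h1, h2⟩ := mem_constrained.1 hσ
  rw [permSum_sub_permSum_switch hd hσ (card_eq_four_iff.1 hq).1, h1, h2, quadWeight, if_pos hq]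
  ring

/-- The difference quotient of `f` at `x` and `y`, with value `f' x` on the diagonal. It is the mean
of `f'` over the segment between `y` and `x`. -/
noncomputable def diffQuot (f : ℝ → ℝ) (x y : ℝ) : ℝ :=
  if x = y then deriv f x else (f x - f y) / (x - y)

theorem sq_mul_diffQuot (f : ℝ → ℝ) (x y : ℝ) :
    (x - y) ^ 2 * diffQuot f x y = (x - y) * (f x - f y) := by
  unfold diffQuot
  split_ifs with h
  · simp [h]
  · have := sub_ne_zero.2 h
    field_simp

/-- The weights `quadWeight` are the squares of the increments of `W`, up to the factor 4, so they
clear the denominators of the difference quotients and leave the Stein identity. -/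
theorem sum_quadWeight_mul_diffQuot {n : ℕ} {d : Fin n → Fin n → ℝ} (hd : IsStandardArray d)
    (f : ℝ → ℝ) :
    ∑ i, ∑ j, ∑ k, ∑ l, quadWeight d i j k l * ∑ σ ∈ constrained i j k l,
      diffQuot f (permSum d σ) (permSum d (switch σ i j)) =
    2 * ((n : ℝ) - 1) * ∑ π ∈ fpfInvolutions n, permSum d π * f (permSum d π) := by
  have h4 : ∀ i j k l, quadWeight d i j k l * ∑ σ ∈ constrained i j k l,
      diffQuot f (permSum d σ) (permSum d (switch σ i j)) =
      ∑ σ ∈ fpfInvolutions n, if σ i = k then if σ j = l then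
        (permSum d σ - permSum d (switch σ i j)) *
          (f (permSum d σ) - f (permSum d (switch σ i j))) / 4 else 0 else 0 := by
    intro i j k l
    simp only [← ite_and]
    rw [← Finset.sum_filter, ← constrained, Finset.mul_sum]
    refine Finset.sum_congr rfl fun σ hσ => ?_
    by_cases hq : ({i, j, k, l} : Finset (Fin n)).card = 4
    · rw [← sq_mul_diffQuot, ← quadWeight_eq hd hq hσ]; ring
    · -- The excluded quadruples have `i = j` or `σ i = j`, and then `switch σ i j = σ`.
      rw [quadWeight, if_neg hq, zero_mul]
      obtain ⟨hmem, hk, hl⟩ := mem_constrained.1 hσ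
      subst hk hl
      have hfix := (mem_fpf.1 hmem).2
      have hinv := (mem_fpf.1 hmem).1
      have hs : switch σ i j = σ := by
        by_cases hij : i = j
        · rw [hij, switch_self]
        by_cases hj : σ i = j
        · exact switch_eq_self hmem hj
        refine absurd (card_eq_four_iff.2 ⟨hij, (hfix i).symm, fun e => hj ?_, Ne.symm hj,
          (hfix j).symm, fun e => hij (σ.injective e)⟩) hq
        rw [e, hinv]
      rw [hs, sub_self, zero_mul, zero_div]
  simp only [h4]
  have h5 : 2 * ((n : ℝ) - 1) * ∑ π ∈ fpfInvolutions n, permSum d π * f (permSum d π) =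
      (8 * ((n : ℝ) - 1) * ∑ π ∈ fpfInvolutions n, permSum d π * f (permSum d π)) / 4 := by ring
  have hcomm : ∀ (s : Finset (Equiv.Perm (Fin n))) (F : Fin n → Fin n → Equiv.Perm (Fin n) → ℝ),
      ∑ a, ∑ b, ∑ σ ∈ s, F a b σ = ∑ σ ∈ s, ∑ a, ∑ b, F a b σ := fun s F =>
    (Finset.sum_congr rfl fun _ _ => Finset.sum_comm).trans Finset.sum_comm
  rw [h5, ← sum_permSum_sub_mul_sub hd f]
  simp only [hcomm, Finset.sum_div, Finset.sum_ite_irrel, Finset.sum_const_zero, Finset.sum_ite_eq,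
    Finset.mem_univ, if_true]

theorem integral_uniformOn_finset {α : Type*} [MeasurableSpace α] [MeasurableSingletonClass α]
    (s : Finset α) (f : α → ℝ) :
    ∫ x, f x ∂(uniformOn (s : Set α)) = (s.card : ℝ)⁻¹ * ∑ x ∈ s, f x := by
  rw [uniformOn, ProbabilityTheory.cond, integral_smul_measure, setIntegral_finset]
  · simp [Measure.count_apply_finset]
  · rw [← Set.biUnion_of_singleton (s : Set α)]
    simp [integrableOn_finset_iUnion]

instance (n : ℕ) : DiscreteMeasurableSpace (Equiv.Perm (Fin n)) := ⟨fun _ => trivial⟩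

theorem sum_permSum_eq_zero {n : ℕ} {d : Fin n → Fin n → ℝ} (hd : IsStandardArray d) :
    ∑ π ∈ fpfInvolutions n, permSum d π = 0 := by
  have h := sum_permSum_sub_mul_sub hd fun _ => 1
  simp only [sub_self, mul_zero, Finset.sum_const_zero, mul_one] at h
  -- The Stein identity is void for `n = 1`, where `W` is a diagonal entry.
  by_cases hn : (n : ℝ) - 1 = 0
  · have hn : n = 1 := by exact_mod_cast (sub_eq_zero.1 hn)
    subst hn
    refine Finset.sum_eq_zero fun π _ => Finset.sum_eq_zero fun i _ => ?_
    rw [Subsingleton.elim (π i) i, hd.diag]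
  · have : (8 : ℝ) * (n - 1) ≠ 0 := mul_ne_zero (by norm_num) hn
    exact (mul_eq_zero.1 h.symm).resolve_left this

theorem fpfInvolutions_nonempty {n : ℕ} {d : Fin n → Fin n → ℝ} (hd : IsStandardArray d) :
    (fpfInvolutions n).Nonempty := by
  by_contra h
  -- `uniformOn ∅` is the zero measure, for which the variance is `0`.
  have := hd.sigmaSq_eq_one
  rw [sigmaSq, Finset.not_nonempty_iff_eq_empty.1 h] at this
  simp at this

theorem sum_permSum_sq {n : ℕ} {d : Fin n → Fin n → ℝ} (hd : IsStandardArray d) :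
    ∑ π ∈ fpfInvolutions n, permSum d π ^ 2 = (fpfInvolutions n).card := by
  have hne := fpfInvolutions_nonempty hd
  have h0 : ((fpfInvolutions n).card : ℝ) ≠ 0 := by exact_mod_cast hne.card_ne_zero
  have : IsProbabilityMeasure (uniformOn (fpfInvolutions n : Set (Equiv.Perm (Fin n)))) :=
    isProbabilityMeasure_uniformOn (Finset.finite_toSet _) hne
  have h := hd.sigmaSq_eq_one
  rw [sigmaSq, variance_of_integral_eq_zero Measurable.of_discrete.aemeasurable,
    integral_uniformOn_finset] at h
  · rw [inv_mul_eq_one₀ h0] at h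
    exact h.symm
  · rw [integral_uniformOn_finset, sum_permSum_eq_zero hd, mul_zero]

theorem two_le_of_isStandardArray {n : ℕ} {d : Fin n → Fin n → ℝ} (hd : IsStandardArray d) :
    2 ≤ n := by
  by_contra hn
  have h := sum_permSum_sq hd
  have : Subsingleton (Fin n) := Fin.subsingleton_iff_le_one.2 (by omega)
  rw [Finset.sum_eq_zero fun π _ => ?_] at h
  · exact (fpfInvolutions_nonempty hd).card_ne_zero (by exact_mod_cast h.symm)
  · rw [permSum, Finset.sum_eq_zero fun i _ => ?_, zero_pow two_ne_zero]
    rw [Subsingleton.elim (π i) i, hd.diag]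

/-- The normalising constant of `p`. -/
noncomputable def totalWeight {n : ℕ} (d : Fin n → Fin n → ℝ) : ℝ :=
  ∑ i, ∑ j, ∑ k, ∑ l, quadWeight d i j k l

theorem quadWeight_nonneg {n : ℕ} (d : Fin n → Fin n → ℝ) (i j k l : Fin n) :
    0 ≤ quadWeight d i j k l := by
  unfold quadWeight; split_ifs <;> positivity

/-- The common size `c` of the sets `constrained i j k l`, and the identity relating it to the
normalising constant, which is the Stein identity for `f = id`. -/
theorem exists_card_constrained_eq {n : ℕ} {d : Fin n → Fin n → ℝ} (hd : IsStandardArray d) :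
    ∃ c : ℝ, 0 < c ∧ 0 < totalWeight d ∧
      c * totalWeight d = 2 * ((n : ℝ) - 1) * (fpfInvolutions n).card ∧
      ((n : ℝ) - 1) * (n - 3) * c ≤ (fpfInvolutions n).card ∧
      ∀ i j k l, ({i, j, k, l} : Finset (Fin n)).card = 4 →
        ((constrained i j k l).card : ℝ) = c := by
  have h := sum_quadWeight_mul_diffQuot hd id
  have h1 : ∀ x y, diffQuot id x y = 1 := fun x y => by
    unfold diffQuot
    split_ifs with h
    · simp
    · exact div_self (sub_ne_zero.2 h)
  simp only [h1, id, ← pow_two, sum_permSum_sq hd, Finset.sum_const, nsmul_eq_mul, mul_one] at h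
  have hpos : 0 < 2 * ((n : ℝ) - 1) * (fpfInvolutions n).card := by
    have h2 : (2 : ℝ) ≤ n := by exact_mod_cast two_le_of_isStandardArray hd
    have h3 : (0 : ℝ) < (fpfInvolutions n).card := by
      exact_mod_cast (fpfInvolutions_nonempty hd).card_pos
    have : (0 : ℝ) < n - 1 := by linarith
    positivity
  obtain ⟨i, j, k, l, hq⟩ : ∃ i j k l : Fin n, ({i, j, k, l} : Finset (Fin n)).card = 4 := by
    by_contra! hno
    simp only [quadWeight, hno, if_false, zero_mul, Finset.sum_const_zero] at h
    exact hpos.ne h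
  have hconst : ∀ i' j' k' l', ({i', j', k', l'} : Finset (Fin n)).card = 4 →
      ((constrained i' j' k' l').card : ℝ) = (constrained i j k l).card := fun i' j' k' l' hq' => by
    exact_mod_cast le_antisymm (card_constrained_le hq' hq) (card_constrained_le hq hq')
  have hZ : ((constrained i j k l).card : ℝ) * totalWeight d =
      2 * ((n : ℝ) - 1) * (fpfInvolutions n).card := by
    rw [← h, totalWeight]
    simp only [Finset.mul_sum]
    refine Finset.sum_congr rfl fun i' _ => Finset.sum_congr rfl fun j' _ =>
      Finset.sum_congr rfl fun k' _ => Finset.sum_congr rfl fun l' _ => ?_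
    by_cases hq' : ({i', j', k', l'} : Finset (Fin n)).card = 4
    · rw [hconst _ _ _ _ hq', mul_comm]
    · simp [quadWeight, hq']
  have hZ0 : 0 ≤ totalWeight d := Finset.sum_nonneg fun _ _ => Finset.sum_nonneg fun _ _ =>
    Finset.sum_nonneg fun _ _ => Finset.sum_nonneg fun _ _ => quadWeight_nonneg d _ _ _ _
  have hprod := hZ ▸ hpos
  exact ⟨_, pos_of_mul_pos_left hprod hZ0, pos_of_mul_pos_right hprod (Nat.cast_nonneg _), hZ,
    card_constrained_mul_le hq, hconst⟩

theorem le_totalWeight {n : ℕ} {d : Fin n → Fin n → ℝ} (hd : IsStandardArray d) :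
    2 * ((n : ℝ) - 1) ^ 2 * (n - 3) ≤ totalWeight d := by
  obtain ⟨c, hc, -, h1, h2, -⟩ := exists_card_constrained_eq hd
  have h3 : (2 : ℝ) ≤ n := by exact_mod_cast two_le_of_isStandardArray hd
  refine le_of_mul_le_mul_left ?_ hc
  rw [h1]
  nlinarith [mul_le_mul_of_nonneg_left h2 (show (0 : ℝ) ≤ 2 * (n - 1) by linarith)]

/-- The mean of `F(π, I, J, K, L)` when `π` is uniform on `Π_n` and `(I, J, K, L)` has law `p`
independently of `π`, written as a finite sum. -/
noncomputable def couplingMean {n : ℕ} (d : Fin n → Fin n → ℝ)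
    (F : Equiv.Perm (Fin n) → Fin n → Fin n → Fin n → Fin n → ℝ) : ℝ :=
  ∑ i, ∑ j, ∑ k, ∑ l, quadProb d i j k l *
    (((fpfInvolutions n).card : ℝ)⁻¹ * ∑ π ∈ fpfInvolutions n, F π i j k l)

/-- The zero bias identity in finite form: the mean of the difference quotient of `f` between `W†`
and `W‡` is `E[W f(W)]`. -/
theorem couplingMean_diffQuot {n : ℕ} {d : Fin n → Fin n → ℝ} (hd : IsStandardArray d)
    (f : ℝ → ℝ) :
    couplingMean d (fun π i j k l =>
      diffQuot f (permSum d (piDag π i j k l)) (permSum d (piDDag π i j k l))) =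
    ((fpfInvolutions n).card : ℝ)⁻¹ * ∑ π ∈ fpfInvolutions n, permSum d π * f (permSum d π) := by
  obtain ⟨c, hc, hZ, h1, -, h2⟩ := exists_card_constrained_eq hd
  have hN : ((fpfInvolutions n).card : ℝ) ≠ 0 := by
    exact_mod_cast (fpfInvolutions_nonempty hd).card_ne_zero
  have hterm : ∀ i j k l, quadProb d i j k l * (((fpfInvolutions n).card : ℝ)⁻¹ *
      ∑ π ∈ fpfInvolutions n,
        diffQuot f (permSum d (piDag π i j k l)) (permSum d (piDDag π i j k l))) =
      (c * totalWeight d)⁻¹ * (quadWeight d i j k l * ∑ σ ∈ constrained i j k l,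
        diffQuot f (permSum d σ) (permSum d (switch σ i j))) := by
    intro i j k l
    by_cases hq : ({i, j, k, l} : Finset (Fin n)).card = 4
    · have h3 := sum_comp_piDag hq fun σ => diffQuot f (permSum d σ) (permSum d (switch σ i j))
      rw [h2 i j k l hq] at h3
      change quadWeight d i j k l / totalWeight d * (((fpfInvolutions n).card : ℝ)⁻¹ *
        ∑ π ∈ fpfInvolutions n, diffQuot f (permSum d (piDag π i j k l))
          (permSum d (switch (piDag π i j k l) i j))) = _
      rw [eq_div_of_mul_eq hc.ne' ((mul_comm _ _).trans h3)]
      field_simp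
    · simp [quadProb, quadWeight, hq]
  have hn : (n : ℝ) - 1 ≠ 0 := by
    have h3 : (2 : ℝ) ≤ n := by exact_mod_cast two_le_of_isStandardArray hd
    linarith
  simp only [couplingMean, hterm, ← Finset.mul_sum]
  rw [sum_quadWeight_mul_diffQuot hd, h1]
  field_simp

/-! ### The pointwise bound and its mean over the involution -/

theorem piDDag_apply_of_notMem {n : ℕ} {π : Equiv.Perm (Fin n)} (hπ : π ∈ fpfInvolutions n)
    {i j k l m : Fin n} (hq : ({i, j, k, l} : Finset (Fin n)).card = 4)
    (hm : m ∉ ({i, j, k, l} : Finset (Fin n))) : piDDag π i j k l m = piDag π i j k l m := by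
  obtain ⟨-, h1, h2⟩ := piDag_mem hπ hq
  simp only [Finset.mem_insert, Finset.mem_singleton, not_or] at hm
  exact switch_apply_of_ne _ hm.1 hm.2.1 (by rw [h1]; exact hm.2.2.1)
    (by rw [h2]; exact hm.2.2.2)

theorem subset_indexSet {n : ℕ} (π : Equiv.Perm (Fin n)) (i j k l : Fin n) :
    ({i, j, k, l} : Finset (Fin n)) ⊆ indexSet π i j k l := by
  intro m hm
  simp only [Finset.mem_insert, Finset.mem_singleton] at hm
  simp only [indexSet, Finset.mem_insert, Finset.mem_singleton]
  tauto

theorem sum_four {n : ℕ} {i j k l : Fin n} (hq : ({i, j, k, l} : Finset (Fin n)).card = 4)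
    (f : Fin n → ℝ) : ∑ m ∈ ({i, j, k, l} : Finset (Fin n)), f m = f i + f j + f k + f l := by
  obtain ⟨hij, hik, hil, hjk, hjl, hkl⟩ := card_eq_four_iff.1 hq
  rw [Finset.sum_insert (by simp [*]), Finset.sum_insert (by simp [*]), Finset.sum_pair hkl]
  ring

theorem sum_insert_le {α : Type*} [DecidableEq α] (a : α) (s : Finset α) {f : α → ℝ}
    (hf : ∀ x, 0 ≤ f x) : ∑ x ∈ insert a s, f x ≤ f a + ∑ x ∈ s, f x := by
  by_cases h : a ∈ s
  · rw [Finset.insert_eq_of_mem h]; linarith [hf a]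
  · rw [Finset.sum_insert h]

/-- The contribution to `∑_{m ∈ 𝓘} |d_{m π†(m)}|` of the points outside `{i, j, k, l}`. These points
have the same partners under `π†` and `π‡`. -/
noncomputable def outerSum {n : ℕ} (d : Fin n → Fin n → ℝ) (π : Equiv.Perm (Fin n))
    (i j k l : Fin n) : ℝ :=
  ∑ m ∈ indexSet π i j k l \ {i, j, k, l}, |d m (piDag π i j k l m)|

theorem abs_permSum_sub_le {n : ℕ} {d : Fin n → Fin n → ℝ} {π ρ : Equiv.Perm (Fin n)}
    {s : Finset (Fin n)} (h : ∀ m ∉ s, ρ m = π m) :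
    |permSum d π - permSum d ρ| ≤ ∑ m ∈ s, |d m (π m)| + ∑ m ∈ s, |d m (ρ m)| := by
  rw [permSum, permSum, ← Finset.sum_sub_distrib, ← Finset.sum_add_distrib,
    ← Finset.sum_subset (Finset.subset_univ s) fun m _ hm => by rw [h m hm, sub_self]]
  exact (Finset.abs_sum_le_sum_abs _ _).trans (Finset.sum_le_sum fun m _ => abs_sub _ _)

theorem sum_indexSet_le {n : ℕ} {d : Fin n → Fin n → ℝ} (hd : IsStandardArray d)
    {π : Equiv.Perm (Fin n)} (hπ : π ∈ fpfInvolutions n) (i j k l : Fin n) :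
    ∑ m ∈ indexSet π i j k l, |d m (π m)| ≤
      2 * (|d i (π i)| + |d j (π j)| + |d k (π k)| + |d l (π l)|) := by
  have h0 : ∀ m, 0 ≤ |d m (π m)| := fun m => abs_nonneg _
  have h1 : ∀ m, |d (π m) (π (π m))| = |d m (π m)| := fun m => by
    rw [(mem_fpf.1 hπ).1, hd.symm]
  rw [indexSet]
  have a1 := sum_insert_le i {j, k, l, π i, π j, π k, π l} h0
  have a2 := sum_insert_le j {k, l, π i, π j, π k, π l} h0
  have a3 := sum_insert_le k {l, π i, π j, π k, π l} h0
  have a4 := sum_insert_le l {π i, π j, π k, π l} h0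
  have a5 := sum_insert_le (π i) {π j, π k, π l} h0
  have a6 := sum_insert_le (π j) {π k, π l} h0
  have a7 := sum_insert_le (π k) {π l} h0
  rw [Finset.sum_singleton] at a7
  rw [h1] at a5 a6 a7
  rw [h1] at a7
  linarith

theorem abs_permSum_sub_piDag_le {n : ℕ} {d : Fin n → Fin n → ℝ} (hd : IsStandardArray d)
    {π : Equiv.Perm (Fin n)} (hπ : π ∈ fpfInvolutions n) {i j k l : Fin n}
    (hq : ({i, j, k, l} : Finset (Fin n)).card = 4) :
    |permSum d π - permSum d (piDag π i j k l)| ≤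
      2 * (|d i (π i)| + |d j (π j)| + |d k (π k)| + |d l (π l)|) + 2 * (|d i k| + |d j l|) +
      outerSum d π i j k l := by
  obtain ⟨hm, h1, h2⟩ := piDag_mem hπ hq
  have h3 := (mem_fpf.1 hm).1 i
  have h4 := (mem_fpf.1 hm).1 j
  rw [h1] at h3
  rw [h2] at h4
  refine (abs_permSum_sub_le fun m hm => piDag_apply_of_notMem π hm).trans ?_
  rw [← Finset.sum_sdiff (subset_indexSet π i j k l) (f := fun m => |d m (piDag π i j k l m)|),
    sum_four hq, h1, h2, h3, h4, hd.symm k i, hd.symm l j]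
  have := sum_indexSet_le hd hπ i j k l
  rw [outerSum]
  linarith

theorem abs_permSum_sub_piDDag_le {n : ℕ} {d : Fin n → Fin n → ℝ} (hd : IsStandardArray d)
    {π : Equiv.Perm (Fin n)} (hπ : π ∈ fpfInvolutions n) {i j k l : Fin n}
    (hq : ({i, j, k, l} : Finset (Fin n)).card = 4) :
    |permSum d π - permSum d (piDDag π i j k l)| ≤
      2 * (|d i (π i)| + |d j (π j)| + |d k (π k)| + |d l (π l)|) + 2 * (|d i j| + |d k l|) +
      outerSum d π i j k l := by
  obtain ⟨hm, h1, h2⟩ := piDag_mem hπ hq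
  obtain ⟨hij, hik, hil, hjk, hjl, hkl⟩ := card_eq_four_iff.1 hq
  have hs : piDDag π i j k l = switch (piDag π i j k l) i j := rfl
  have h3 : piDDag π i j k l i = j := switch_apply_left hm hij
  have h4 : piDDag π i j k l j = i := switch_apply_right hm hij
  have h5 : piDDag π i j k l k = l := by
    have := switch_apply_apply hm hij
    rwa [h1, h2] at this
  have h6 := (mem_fpf.1 (switch_mem_fpf hm i j)).1 k
  rw [← hs, h5] at h6
  refine (abs_permSum_sub_le (s := indexSet π i j k l) fun m hm => ?_).trans ?_
  · rw [piDDag_apply_of_notMem hπ hq fun h => hm (subset_indexSet π i j k l h),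
      piDag_apply_of_notMem π hm]
  rw [← Finset.sum_sdiff (subset_indexSet π i j k l) (f := fun m => |d m (piDDag π i j k l m)|),
    sum_four hq, h3, h4, h5, h6, hd.symm j i, hd.symm l k]
  have hout : ∑ m ∈ indexSet π i j k l \ {i, j, k, l}, |d m (piDDag π i j k l m)| =
      outerSum d π i j k l := Finset.sum_congr rfl fun m hm => by
    rw [piDDag_apply_of_notMem hπ hq (Finset.mem_sdiff.1 hm).2]
  have := sum_indexSet_le hd hπ i j k l
  rw [hout]
  linarith

/-- An upper bound for `|W - W*|` that does not involve `U`: the pairs of `π` at `i, j, k, l`, the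
pairs that `π†` or `π‡` forms among `i, j, k, l`, and the other new pairs. -/
noncomputable def gapBound {n : ℕ} (d : Fin n → Fin n → ℝ) (π : Equiv.Perm (Fin n))
    (i j k l : Fin n) : ℝ :=
  2 * (|d i (π i)| + |d j (π j)| + |d k (π k)| + |d l (π l)|) +
    2 * max (|d i k| + |d j l|) (|d i j| + |d k l|) + outerSum d π i j k l

theorem abs_sub_interpolation_le_gapBound {n : ℕ} {d : Fin n → Fin n → ℝ} (hd : IsStandardArray d)
    {π : Equiv.Perm (Fin n)} (hπ : π ∈ fpfInvolutions n) {i j k l : Fin n}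
    (hq : ({i, j, k, l} : Finset (Fin n)).card = 4) {u : ℝ} (hu : u ∈ Set.Icc (0 : ℝ) 1) :
    |permSum d π - (u * permSum d (piDag π i j k l) + (1 - u) * permSum d (piDDag π i j k l))| ≤
      gapBound d π i j k l := by
  have h1 := abs_permSum_sub_piDag_le hd hπ hq
  have h2 := abs_permSum_sub_piDDag_le hd hπ hq
  have h3 := le_max_left (|d i k| + |d j l|) (|d i j| + |d k l|)
  have h4 := le_max_right (|d i k| + |d j l|) (|d i j| + |d k l|)
  have h1' : |permSum d π - permSum d (piDag π i j k l)| ≤ gapBound d π i j k l := by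
    rw [gapBound]; linarith
  have h2' : |permSum d π - permSum d (piDDag π i j k l)| ≤ gapBound d π i j k l := by
    rw [gapBound]; linarith
  have h5 : permSum d π - (u * permSum d (piDag π i j k l) + (1 - u) * permSum d (piDDag π i j k l))
      = u * (permSum d π - permSum d (piDag π i j k l)) +
        (1 - u) * (permSum d π - permSum d (piDDag π i j k l)) := by ring
  rw [abs_le] at h1' h2' ⊢
  have hu' : 0 ≤ 1 - u := by linarith [hu.2]
  rw [h5]
  constructor
  · nlinarith [mul_le_mul_of_nonneg_left h1'.1 hu.1, mul_le_mul_of_nonneg_left h2'.1 hu']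
  · nlinarith [mul_le_mul_of_nonneg_left h1'.2 hu.1, mul_le_mul_of_nonneg_left h2'.2 hu']

theorem sum_fpf_abs_apply {n : ℕ} {d : Fin n → Fin n → ℝ} (hd : IsStandardArray d) (a : Fin n) :
    ((n : ℝ) - 1) * ∑ π ∈ fpfInvolutions n, |d a (π a)| =
      (fpfInvolutions n).card * ∑ m, |d a m| := by
  rw [← Finset.sum_fiberwise (s := fpfInvolutions n) (g := fun π => π a), Finset.mul_sum,
    Finset.mul_sum]
  refine Finset.sum_congr rfl fun m _ => ?_
  rw [Finset.sum_congr rfl (g := fun _ => |d a m|) fun π hπ => by rw [(Finset.mem_filter.1 hπ).2],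
    Finset.sum_const, nsmul_eq_mul, ← mul_assoc]
  by_cases h : a = m
  · rw [h, hd.diag]; simp
  · rw [card_filter_apply_eq h]

theorem sum_fpf_outerSum_le {n : ℕ} {d : Fin n → Fin n → ℝ} (hd : IsStandardArray d)
    {i j k l : Fin n} (hq : ({i, j, k, l} : Finset (Fin n)).card = 4) (hn : 6 ≤ n) :
    (∑ π ∈ fpfInvolutions n, outerSum d π i j k l) * (((n : ℝ) - 4) * (n - 5)) ≤
      (fpfInvolutions n).card * (4 * ∑ m, ∑ m', |d m m'|) := by
  set Q : Finset (Fin n) := {i, j, k, l} with hQ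
  have hset : ∀ π : Equiv.Perm (Fin n), indexSet π i j k l \ Q ⊆ (Q.image π) \ Q := by
    intro π m hm
    rw [Finset.mem_sdiff] at hm ⊢
    refine ⟨?_, hm.2⟩
    obtain ⟨h1, h2⟩ := hm
    simp only [hQ, indexSet, Finset.mem_insert, Finset.mem_singleton, Finset.mem_image,
      exists_eq_or_imp, exists_eq_left] at h1 h2 ⊢
    tauto
  have h1 : ∀ π ∈ fpfInvolutions n, outerSum d π i j k l ≤
      ∑ a ∈ Q, ∑ m ∈ Qᶜ, ∑ m', if π a = m ∧ piDag π i j k l m = m' then |d m m'| else 0 := by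
    intro π _
    rw [outerSum]
    refine (Finset.sum_le_sum_of_subset_of_nonneg (hset π) fun _ _ _ => abs_nonneg _).trans ?_
    rw [← Finset.filter_notMem_eq_sdiff, Finset.filter_image,
      Finset.sum_image fun a _ b _ h => π.injective h, Finset.sum_filter]
    refine Finset.sum_le_sum fun a _ => ?_
    simp only [ite_and, Finset.sum_ite_irrel, Finset.sum_const_zero, Finset.sum_ite_eq,
      Finset.mem_univ, if_true, Finset.mem_compl]
    exact le_rfl
  have h2 : ∀ a ∈ Q, ∀ m ∈ Qᶜ, ∀ m', (∑ π ∈ fpfInvolutions n,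
      if π a = m ∧ piDag π i j k l m = m' then |d m m'| else 0) * (((n : ℝ) - 4) * (n - 5)) ≤
      (fpfInvolutions n).card * |d m m'| := by
    intro a ha m hm m'
    rw [Finset.mem_compl] at hm
    rw [← Finset.sum_filter, Finset.sum_const, nsmul_eq_mul]
    by_cases hmm : m = m'
    · rw [hmm, hd.diag]; simp
    by_cases hm' : m' ∈ Q
    · -- `π†` matches the points of the quadruple among themselves.
      rw [Finset.filter_eq_empty_iff.2]
      · simp; positivity
      · rintro π hπ ⟨-, h⟩
        obtain ⟨hmem, h3, h4⟩ := piDag_mem hπ hq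
        have h5 := (mem_fpf.1 hmem).1
        have h6 := h5 i
        have h7 := h5 j
        have h8 := h5 m
        rw [h3] at h6
        rw [h4] at h7
        rw [h] at h8
        apply hm
        simp only [hQ, Finset.mem_insert, Finset.mem_singleton] at hm' ⊢
        rcases hm' with rfl | rfl | rfl | rfl
        · right; right; left; rw [← h8, h3]
        · right; right; right; rw [← h8, h4]
        · left; rw [← h8, h6]
        · right; left; rw [← h8, h7]
    · rw [mul_right_comm]
      exact mul_le_mul_of_nonneg_right (card_pair_mul_le hq ha hm hm' hmm hn) (abs_nonneg _)
  have hn4 : (0 : ℝ) ≤ (n - 4) * (n - 5) := by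
    have : (6 : ℝ) ≤ n := by exact_mod_cast hn
    exact mul_nonneg (by linarith) (by linarith)
  refine (mul_le_mul_of_nonneg_right (Finset.sum_le_sum h1) hn4).trans ?_
  have hfour : 4 * ∑ m, ∑ m', |d m m'| = ∑ a ∈ Q, ∑ m, ∑ m', |d m m'| := by
    rw [Finset.sum_const, hq, nsmul_eq_mul, Nat.cast_ofNat]
  rw [hfour, Finset.sum_comm, Finset.sum_mul, Finset.mul_sum]
  refine Finset.sum_le_sum fun a ha => ?_
  rw [Finset.sum_comm, Finset.sum_mul, Finset.mul_sum]
  refine (Finset.sum_le_sum (g := fun m => ((fpfInvolutions n).card : ℝ) * ∑ m', |d m m'|)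
    fun m hm => ?_).trans (Finset.sum_le_sum_of_subset_of_nonneg (Finset.subset_univ Qᶜ)
      fun _ _ _ => by positivity)
  rw [Finset.sum_comm, Finset.sum_mul, Finset.mul_sum]
  exact Finset.sum_le_sum fun m' _ => h2 a ha m hm m'

/-! ### The mean over the quadruple -/

/-- A case of Chebyshev's sum inequality. -/
theorem sum_sq_mul_sum_le {ι : Type*} [Fintype ι] {x : ι → ℝ} (hx : ∀ a, 0 ≤ x a) :
    (∑ a, x a ^ 2) * ∑ a, x a ≤ Fintype.card ι * ∑ a, x a ^ 3 := by
  have h : ∀ a b, x a ^ 2 * x b ≤ (2 * x a ^ 3 + x b ^ 3) / 3 := fun a b => by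
    nlinarith [mul_nonneg (hx a) (sq_nonneg (x a - x b)), mul_nonneg (hx b) (sq_nonneg (x a - x b))]
  rw [Finset.sum_mul_sum]
  refine (Finset.sum_le_sum fun a _ => Finset.sum_le_sum fun b _ => h a b).trans (le_of_eq ?_)
  simp only [add_div, Finset.sum_add_distrib, Finset.sum_const, Finset.card_univ, nsmul_eq_mul,
    ← Finset.mul_sum, ← Finset.sum_div]
  ring

/-- The sum runs over all `j, k, l`, not only over distinct indices; this makes every cross term
vanish, as the rows and columns of `d` sum to zero. -/
theorem sum_quad_sq {n : ℕ} {d : Fin n → Fin n → ℝ} (hd : IsStandardArray d) (i : Fin n) :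
    ∑ j, ∑ k, ∑ l, (d i k + d j l - (d i j + d k l)) ^ 2 =
      2 * (n : ℝ) ^ 2 * ∑ a, d i a ^ 2 + 2 * n * ∑ a, ∑ b, d a b ^ 2 := by
  have hl : ∀ j k, ∑ l, (d i k + d j l - (d i j + d k l)) ^ 2 =
      n * d i k ^ 2 + n * d i j ^ 2 - 2 * n * d i j * d i k + ∑ l, d j l ^ 2 + ∑ l, d k l ^ 2
        - 2 * ∑ l, d j l * d k l := fun j k => by
    have : ∀ l, (d i k + d j l - (d i j + d k l)) ^ 2 = (d i k - d i j) ^ 2 + d j l ^ 2 + d k l ^ 2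
        - 2 * (d j l * d k l) + 2 * (d i k - d i j) * d j l - 2 * (d i k - d i j) * d k l :=
      fun l => by ring
    simp only [this, Finset.sum_add_distrib, Finset.sum_sub_distrib, ← Finset.mul_sum, hd.row_sum,
      Finset.sum_const, Finset.card_univ, Fintype.card_fin, nsmul_eq_mul]
    ring
  have hk : ∀ j, ∑ k, ∑ l, d j l * d k l = 0 := fun j => by
    rw [Finset.sum_comm]
    refine Finset.sum_eq_zero fun l _ => ?_
    rw [← Finset.mul_sum, Finset.sum_congr rfl fun k _ => hd.symm k l, hd.row_sum, mul_zero]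
  simp only [hl, Finset.sum_add_distrib, Finset.sum_sub_distrib, ← Finset.mul_sum, hd.row_sum, hk,
    Finset.sum_const, Finset.card_univ, Fintype.card_fin, nsmul_eq_mul]
  simp
  ring

theorem quadWeight_le {n : ℕ} (d : Fin n → Fin n → ℝ) (i j k l : Fin n) :
    quadWeight d i j k l ≤ (d i k + d j l - (d i j + d k l)) ^ 2 := by
  unfold quadWeight; split_ifs
  · exact le_rfl
  · positivity

theorem sq_mul_max_le (a b c e : ℝ) :
    (a + b - (c + e)) ^ 2 * max (|a| + |b|) (|c| + |e|) ≤
      10 * (|a| ^ 3 + |b| ^ 3 + |c| ^ 3 + |e| ^ 3) := by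
  have hsq : (a + b - (c + e)) ^ 2 ≤ (|a| + |b| + (|c| + |e|)) ^ 2 := by
    rw [← sq_abs]
    have h1 := abs_sub (a + b) (c + e)
    have h2 := abs_add_le a b
    have h3 := abs_add_le c e
    gcongr
    linarith
  have hcube : ∀ x y : ℝ, 0 ≤ x → 0 ≤ y → (x + y) ^ 3 ≤ 4 * (x ^ 3 + y ^ 3) := fun x y hx hy => by
    nlinarith [mul_nonneg (add_nonneg hx hy) (sq_nonneg (x - y))]
  have hmax : ∀ X Y : ℝ, 0 ≤ X → 0 ≤ Y → (X + Y) ^ 2 * X ≤ 5 / 2 * (X ^ 3 + Y ^ 3) :=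
    fun X Y hX hY => by
      -- For `X = 1` the cubic in `Y` has its minimum at `Y = 2 / 3`.
      nlinarith [mul_nonneg hX (sq_nonneg (3 * Y - 2 * X)),
        mul_nonneg hY (sq_nonneg (3 * Y - 2 * X)), pow_nonneg hX 3]
  have h1 := hcube |a| |b| (abs_nonneg _) (abs_nonneg _)
  have h2 := hcube |c| |e| (abs_nonneg _) (abs_nonneg _)
  have hX : 0 ≤ |a| + |b| := by positivity
  have hY : 0 ≤ |c| + |e| := by positivity
  refine (mul_le_mul_of_nonneg_right hsq (le_max_of_le_left hX)).trans ?_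
  rcases max_choice (|a| + |b|) (|c| + |e|) with h | h <;> rw [h]
  · linarith [hmax _ _ hX hY]
  · rw [add_comm (|a| + |b|)]
    linarith [hmax _ _ hY hX]

/-- The square is invariant under the relabellings `(j, i, l, k)` and `(k, l, i, j)` of
`(i, j, k, l)`, so its four marginals agree. -/
theorem sum_quad_sq_mul {n : ℕ} {d : Fin n → Fin n → ℝ} (hd : IsStandardArray d) (g : Fin n → ℝ) :
    ∑ i, ∑ j, ∑ k, ∑ l, (d i k + d j l - (d i j + d k l)) ^ 2 * (g i + g j + g k + g l) =
      4 * ∑ i, (2 * (n : ℝ) ^ 2 * ∑ a, d i a ^ 2 + 2 * n * ∑ a, ∑ b, d a b ^ 2) * g i := by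
  set A : Fin n → ℝ := fun i => 2 * (n : ℝ) ^ 2 * ∑ a, d i a ^ 2 + 2 * n * ∑ a, ∑ b, d a b ^ 2
  have hA : ∀ i, ∑ j, ∑ k, ∑ l, (d i k + d j l - (d i j + d k l)) ^ 2 = A i := sum_quad_sq hd
  have h1 : ∑ i, ∑ j, ∑ k, ∑ l, (d i k + d j l - (d i j + d k l)) ^ 2 * g i = ∑ i, A i * g i := by
    simp only [← Finset.sum_mul, hA]
  have h2 : ∑ i, ∑ j, ∑ k, ∑ l, (d i k + d j l - (d i j + d k l)) ^ 2 * g j = ∑ i, A i * g i := by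
    rw [Finset.sum_comm]
    refine Finset.sum_congr rfl fun j _ => ?_
    simp only [← Finset.sum_mul, ← hA]
    congr 1
    refine Finset.sum_congr rfl fun i _ => ?_
    rw [Finset.sum_comm]
    refine Finset.sum_congr rfl fun l _ => Finset.sum_congr rfl fun k _ => ?_
    rw [hd.symm j i, hd.symm l k]; ring
  have hcomm : ∀ F : Fin n → Fin n → Fin n → Fin n → ℝ,
      ∑ i, ∑ j, ∑ k, ∑ l, F i j k l = ∑ k, ∑ l, ∑ i, ∑ j, F i j k l := fun F => by
    rw [Finset.sum_congr rfl fun i _ => Finset.sum_comm, Finset.sum_comm]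
    refine Finset.sum_congr rfl fun k _ => ?_
    rw [Finset.sum_congr rfl fun i _ => Finset.sum_comm, Finset.sum_comm]
  have h3 : ∑ i, ∑ j, ∑ k, ∑ l, (d i k + d j l - (d i j + d k l)) ^ 2 * g k = ∑ i, A i * g i := by
    rw [← h1, hcomm]
    refine Finset.sum_congr rfl fun k _ => Finset.sum_congr rfl fun l _ =>
      Finset.sum_congr rfl fun i _ => Finset.sum_congr rfl fun j _ => ?_
    rw [hd.symm k i, hd.symm l j]; ring
  have h4 : ∑ i, ∑ j, ∑ k, ∑ l, (d i k + d j l - (d i j + d k l)) ^ 2 * g l = ∑ i, A i * g i := by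
    rw [← h2, hcomm]
    refine Finset.sum_congr rfl fun k _ => Finset.sum_congr rfl fun l _ =>
      Finset.sum_congr rfl fun i _ => Finset.sum_congr rfl fun j _ => ?_
    rw [hd.symm k i, hd.symm l j]; ring
  simp only [mul_add, Finset.sum_add_distrib, h1, h2, h3, h4]
  ring

theorem betaArray_eq {n : ℕ} {d : Fin n → Fin n → ℝ} (hd : IsStandardArray d) :
    betaArray d = ∑ i, ∑ j, |d i j| ^ 3 := by
  have hcol : ∀ j, ∑ k, d k j = 0 := fun j => by
    rw [Finset.sum_congr rfl fun k _ => hd.symm k j, hd.row_sum]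
  refine Finset.sum_congr rfl fun i _ => Finset.sum_congr rfl fun j _ => ?_
  by_cases h : i = j
  · simp [h, hd.diag]
  · simp [h, hatArray, hd.row_sum, hcol, hd.sigmaSq_eq_one]

theorem totalWeight_le {n : ℕ} {d : Fin n → Fin n → ℝ} (hd : IsStandardArray d) :
    totalWeight d ≤ 4 * (n : ℝ) ^ 2 * ∑ i, ∑ j, d i j ^ 2 := by
  refine (Finset.sum_le_sum fun i _ => Finset.sum_le_sum fun j _ => Finset.sum_le_sum fun k _ =>
    Finset.sum_le_sum fun l _ => quadWeight_le d i j k l).trans (le_of_eq ?_)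
  simp only [sum_quad_sq hd, Finset.sum_add_distrib, ← Finset.mul_sum, Finset.sum_const,
    Finset.card_univ, Fintype.card_fin, nsmul_eq_mul]
  ring

theorem sum_sq_mul_sum_abs_le {n : ℕ} {d : Fin n → Fin n → ℝ} (hd : IsStandardArray d) :
    (∑ i, ∑ j, d i j ^ 2) * ∑ i, ∑ j, |d i j| ≤ (n : ℝ) ^ 2 * betaArray d := by
  have := sum_sq_mul_sum_le (ι := Fin n × Fin n) (x := fun p => |d p.1 p.2|) fun p => abs_nonneg _
  simp only [Fintype.sum_prod_type, sq_abs, Fintype.card_prod, Fintype.card_fin] at this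
  rw [betaArray_eq hd]
  push_cast at this
  rwa [pow_two (n : ℝ)]

theorem sum_row_sq_mul_row_abs_le {n : ℕ} {d : Fin n → Fin n → ℝ} (hd : IsStandardArray d) :
    ∑ i, (∑ j, d i j ^ 2) * ∑ j, |d i j| ≤ n * betaArray d := by
  rw [betaArray_eq hd, Finset.mul_sum]
  refine Finset.sum_le_sum fun i _ => ?_
  have := sum_sq_mul_sum_le (x := fun j => |d i j|) fun p => abs_nonneg _
  simpa only [sq_abs, Fintype.card_fin] using this

theorem sum_quadWeight_mul_row_le {n : ℕ} {d : Fin n → Fin n → ℝ} (hd : IsStandardArray d) :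
    ∑ i, ∑ j, ∑ k, ∑ l, quadWeight d i j k l *
      (∑ m, |d i m| + ∑ m, |d j m| + ∑ m, |d k m| + ∑ m, |d l m|) ≤
    16 * (n : ℝ) ^ 3 * betaArray d := by
  have h0 : ∀ i, 0 ≤ ∑ m, |d i m| := fun i => Finset.sum_nonneg fun _ _ => abs_nonneg _
  refine (Finset.sum_le_sum fun i _ => Finset.sum_le_sum fun j _ => Finset.sum_le_sum fun k _ =>
    Finset.sum_le_sum fun l _ => mul_le_mul_of_nonneg_right (quadWeight_le d i j k l)
      (add_nonneg (add_nonneg (add_nonneg (h0 i) (h0 j)) (h0 k)) (h0 l))).trans ?_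
  rw [sum_quad_sq_mul hd fun i => ∑ m, |d i m|]
  simp only [add_mul, Finset.sum_add_distrib, mul_assoc, ← Finset.mul_sum]
  have h1 := mul_le_mul_of_nonneg_left (sum_row_sq_mul_row_abs_le hd) (sq_nonneg (n : ℝ))
  have h2 := mul_le_mul_of_nonneg_left (sum_sq_mul_sum_abs_le hd) (Nat.cast_nonneg (α := ℝ) n)
  nlinarith

theorem sum_quadWeight_mul_max_le {n : ℕ} {d : Fin n → Fin n → ℝ} (hd : IsStandardArray d) :
    ∑ i, ∑ j, ∑ k, ∑ l, quadWeight d i j k l * max (|d i k| + |d j l|) (|d i j| + |d k l|) ≤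
    40 * (n : ℝ) ^ 2 * betaArray d := by
  have h : ∀ i j k l, quadWeight d i j k l * max (|d i k| + |d j l|) (|d i j| + |d k l|) ≤
      10 * (|d i k| ^ 3 + |d j l| ^ 3 + |d i j| ^ 3 + |d k l| ^ 3) := fun i j k l =>
    (mul_le_mul_of_nonneg_right (quadWeight_le d i j k l)
      (le_max_of_le_left (by positivity))).trans (sq_mul_max_le _ _ _ _)
  refine (Finset.sum_le_sum fun i _ => Finset.sum_le_sum fun j _ => Finset.sum_le_sum fun k _ =>
    Finset.sum_le_sum fun l _ => h i j k l).trans (le_of_eq ?_)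
  simp only [Finset.sum_add_distrib, ← Finset.mul_sum, Finset.sum_const,
    Finset.card_univ, Fintype.card_fin, nsmul_eq_mul, betaArray_eq hd]
  ring

theorem couplingMean_le {n : ℕ} {d : Fin n → Fin n → ℝ} (hd : IsStandardArray d)
    {F : Equiv.Perm (Fin n) → Fin n → Fin n → Fin n → Fin n → ℝ}
    {H : Fin n → Fin n → Fin n → Fin n → ℝ}
    (h : ∀ i j k l, ({i, j, k, l} : Finset (Fin n)).card = 4 →
      ∑ π ∈ fpfInvolutions n, F π i j k l ≤ (fpfInvolutions n).card * H i j k l) :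
    couplingMean d F ≤ (∑ i, ∑ j, ∑ k, ∑ l, quadWeight d i j k l * H i j k l) / totalWeight d := by
  have hN : (0 : ℝ) < (fpfInvolutions n).card := by
    exact_mod_cast (fpfInvolutions_nonempty hd).card_pos
  obtain ⟨-, -, hZ, -⟩ := exists_card_constrained_eq hd
  simp only [Finset.sum_div]
  refine Finset.sum_le_sum fun i _ => Finset.sum_le_sum fun j _ => Finset.sum_le_sum fun k _ =>
    Finset.sum_le_sum fun l _ => ?_
  rw [quadProb, ← totalWeight, div_mul_eq_mul_div]
  refine div_le_div_of_nonneg_right ?_ hZ.le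
  by_cases hq : ({i, j, k, l} : Finset (Fin n)).card = 4
  · refine mul_le_mul_of_nonneg_left ?_ (quadWeight_nonneg d i j k l)
    rw [inv_mul_le_iff₀ hN]
    exact h i j k l hq
  · simp [quadWeight, hq]

/-- The three summands on the left are the contributions of the three parts of `gapBound`, in units
of `β`. After the shift `m = x + 9` the difference has positive coefficients. -/
theorem gap_coefficient_le {m : ℝ} (hm : 9 ≤ m) :
    16 * m ^ 3 / ((m - 1) ^ 3 * (m - 3)) + 40 * m ^ 2 / ((m - 1) ^ 2 * (m - 3)) +
      8 * m ^ 4 / ((m - 1) ^ 2 * (m - 3) * ((m - 4) * (m - 5))) ≤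
    112 / m + 672 / m ^ 2 + 192 / m ^ 3 := by
  obtain ⟨x, hx, rfl⟩ : ∃ x : ℝ, 0 ≤ x ∧ m = x + 9 := ⟨m - 9, by linarith, by ring⟩
  rw [show x + 9 - 1 = x + 8 by ring, show x + 9 - 3 = x + 6 by ring,
    show x + 9 - 4 = x + 5 by ring, show x + 9 - 5 = x + 4 by ring, ← sub_nonneg]
  have : 112 / (x + 9) + 672 / (x + 9) ^ 2 + 192 / (x + 9) ^ 3 -
      (16 * (x + 9) ^ 3 / ((x + 8) ^ 3 * (x + 6)) + 40 * (x + 9) ^ 2 / ((x + 8) ^ 2 * (x + 6)) +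
      8 * (x + 9) ^ 4 / ((x + 8) ^ 2 * (x + 6) * ((x + 5) * (x + 4)))) =
      (48 * x ^ 8 + 3000 * x ^ 7 + 78400 * x ^ 6 + 1119208 * x ^ 5 + 9502272 * x ^ 4 +
        48566680 * x ^ 3 + 142234896 * x ^ 2 + 204577032 * x + 86684544) /
      ((x + 9) ^ 3 * (x + 8) ^ 3 * (x + 6) * (x + 5) * (x + 4)) := by
    field_simp
    ring
  rw [this]
  positivity

theorem couplingMean_gapBound_le {n : ℕ} {d : Fin n → Fin n → ℝ} (hd : IsStandardArray d)
    (hn : 9 ≤ n) :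
    couplingMean d (gapBound d) ≤
      112 * betaArray d / n + 672 * betaArray d / (n : ℝ) ^ 2 +
        192 * betaArray d / (n : ℝ) ^ 3 := by
  obtain ⟨-, -, hZ, -⟩ := exists_card_constrained_eq hd
  have hn' : (9 : ℝ) ≤ n := by exact_mod_cast hn
  set R := ∑ i, ∑ j, d i j ^ 2 with hR
  set Q := ∑ i, ∑ j, |d i j| with hQ
  set β := betaArray d
  set Z := totalWeight d with hZdef
  have hQ0 : 0 ≤ Q := Finset.sum_nonneg fun _ _ => Finset.sum_nonneg fun _ _ => abs_nonneg _
  have hβ : 0 ≤ β := by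
    rw [show β = _ from betaArray_eq hd]; positivity
  have hmean := couplingMean_le hd (F := gapBound d) (H := fun i j k l =>
    2 / ((n : ℝ) - 1) * (∑ m, |d i m| + ∑ m, |d j m| + ∑ m, |d k m| + ∑ m, |d l m|) +
    2 * max (|d i k| + |d j l|) (|d i j| + |d k l|) + 4 * Q / (((n : ℝ) - 4) * (n - 5))) (by
    intro i j k l hq
    have h1 : ∀ a, ∑ π ∈ fpfInvolutions n, |d a (π a)| =
        (fpfInvolutions n).card * ((1 / ((n : ℝ) - 1)) * ∑ m, |d a m|) := fun a => by
      have := sum_fpf_abs_apply hd a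
      have h0 : (n : ℝ) - 1 ≠ 0 := by linarith
      field_simp
      linarith
    have h2 := sum_fpf_outerSum_le hd hq (by omega)
    rw [← le_div_iff₀ (mul_pos (by linarith) (by linarith))] at h2
    simp only [gapBound, Finset.sum_add_distrib, ← Finset.mul_sum, h1, Finset.sum_const,
      nsmul_eq_mul]
    rw [← hQ, mul_div_assoc] at h2
    have h3 : (2 : ℝ) / (n - 1) = 2 * (1 / (n - 1)) := by ring
    rw [h3]
    linarith)
  have h1 := sum_quadWeight_mul_row_le hd
  have h2 := sum_quadWeight_mul_max_le hd
  have hsum : ∑ i, ∑ j, ∑ k, ∑ l, quadWeight d i j k l * (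
      2 / ((n : ℝ) - 1) * (∑ m, |d i m| + ∑ m, |d j m| + ∑ m, |d k m| + ∑ m, |d l m|) +
      2 * max (|d i k| + |d j l|) (|d i j| + |d k l|) + 4 * Q / (((n : ℝ) - 4) * (n - 5))) ≤
      2 / ((n : ℝ) - 1) * (16 * (n : ℝ) ^ 3 * β) + 2 * (40 * (n : ℝ) ^ 2 * β) +
        4 * Q / (((n : ℝ) - 4) * (n - 5)) * Z := by
    have hn1 : 0 ≤ 2 / ((n : ℝ) - 1) := div_nonneg (by norm_num) (by linarith)
    refine le_trans (le_of_eq ?_) (add_le_add (add_le_add (mul_le_mul_of_nonneg_left h1 hn1)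
      (mul_le_mul_of_nonneg_left h2 zero_le_two)) le_rfl)
    rw [hZdef, totalWeight]
    simp only [Finset.mul_sum, ← Finset.sum_add_distrib]
    refine Finset.sum_congr rfl fun i _ => Finset.sum_congr rfl fun j _ =>
      Finset.sum_congr rfl fun k _ => Finset.sum_congr rfl fun l _ => ?_
    simp only [← Finset.mul_sum]
    ring
  have hZ1 : 2 * ((n : ℝ) - 1) ^ 2 * (n - 3) ≤ Z := le_totalWeight hd
  have hZ2 : Z ≤ 4 * (n : ℝ) ^ 2 * R := totalWeight_le hd
  have hRQ : R * Q ≤ (n : ℝ) ^ 2 * β := sum_sq_mul_sum_abs_le hd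
  -- `Q Z ≤ 4 n² Q R ≤ 4 n⁴ β`
  have hQZ : Q ≤ 4 * (n : ℝ) ^ 4 * β / Z := by
    rw [le_div_iff₀ hZ]
    nlinarith [mul_le_mul_of_nonneg_left hZ2 hQ0, mul_le_mul_of_nonneg_left hRQ (sq_nonneg (n : ℝ))]
  refine hmean.trans ((div_le_div_of_nonneg_right hsum hZ.le).trans ?_)
  have hL : 0 < 2 * ((n : ℝ) - 1) ^ 2 * (n - 3) :=
    mul_pos (mul_pos two_pos (pow_pos (by linarith) 2)) (by linarith)
  have h45 : 0 < ((n : ℝ) - 4) * (n - 5) := mul_pos (by linarith) (by linarith)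
  have hn1 : 0 < (n : ℝ) - 1 := by linarith
  calc (2 / ((n : ℝ) - 1) * (16 * (n : ℝ) ^ 3 * β) + 2 * (40 * (n : ℝ) ^ 2 * β) +
        4 * Q / (((n : ℝ) - 4) * (n - 5)) * Z) / Z
      = (2 / ((n : ℝ) - 1) * (16 * (n : ℝ) ^ 3 * β) + 2 * (40 * (n : ℝ) ^ 2 * β)) / Z +
        4 * Q / (((n : ℝ) - 4) * (n - 5)) := by
          rw [add_div, mul_div_cancel_right₀ _ hZ.ne']
    _ ≤ (2 / ((n : ℝ) - 1) * (16 * (n : ℝ) ^ 3 * β) + 2 * (40 * (n : ℝ) ^ 2 * β)) / Z +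
        4 * (4 * (n : ℝ) ^ 4 * β / Z) / (((n : ℝ) - 4) * (n - 5)) := by gcongr
    _ ≤ (2 / ((n : ℝ) - 1) * (16 * (n : ℝ) ^ 3 * β) + 2 * (40 * (n : ℝ) ^ 2 * β)) /
          (2 * ((n : ℝ) - 1) ^ 2 * (n - 3)) +
        4 * (4 * (n : ℝ) ^ 4 * β / (2 * ((n : ℝ) - 1) ^ 2 * (n - 3))) /
          (((n : ℝ) - 4) * (n - 5)) := by gcongr
    _ = β * (16 * (n : ℝ) ^ 3 / (((n : ℝ) - 1) ^ 3 * (n - 3)) +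
        40 * (n : ℝ) ^ 2 / (((n : ℝ) - 1) ^ 2 * (n - 3)) +
        8 * (n : ℝ) ^ 4 / (((n : ℝ) - 1) ^ 2 * (n - 3) * ((n - 4) * (n - 5)))) := by
      have h3 : (n : ℝ) - 3 ≠ 0 := by linarith
      have h4 : (n : ℝ) - 4 ≠ 0 := by linarith
      have h5 : (n : ℝ) - 5 ≠ 0 := by linarith
      have h1 : (n : ℝ) - 1 ≠ 0 := hn1.ne'
      field_simp
      ring
    _ ≤ β * (112 / n + 672 / (n : ℝ) ^ 2 + 192 / (n : ℝ) ^ 3) :=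
      mul_le_mul_of_nonneg_left (gap_coefficient_le hn') hβ
    _ = _ := by ring

/-! ### From the probability space to finite sums -/

theorem setIntegral_deriv_segment {f : ℝ → ℝ} (hf : Differentiable ℝ f) (x y : ℝ)
    (hint : IntegrableOn (fun u : ℝ => deriv f (u * x + (1 - u) * y)) (Set.Icc 0 1)) :
    ∫ u in Set.Icc (0 : ℝ) 1, deriv f (u * x + (1 - u) * y) = diffQuot f x y := by
  unfold diffQuot
  split_ifs with h
  · subst h
    have : ∀ u : ℝ, u * x + (1 - u) * x = x := fun u => by ring
    simp [this]
  · have hderiv : ∀ u : ℝ, HasDerivAt (fun u => f (u * x + (1 - u) * y))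
        ((x - y) * deriv f (u * x + (1 - u) * y)) u := fun u => by
      have h1 : HasDerivAt (fun u : ℝ => u * x + (1 - u) * y) (x - y) u := by
        have := ((hasDerivAt_id' u).mul_const (x - y)).add_const y
        rw [one_mul] at this
        exact this.congr_of_eventuallyEq (.of_forall fun v => by ring)
      have := (hf (u * x + (1 - u) * y)).hasDerivAt.comp u h1
      rwa [mul_comm] at this
    have hI : IntervalIntegrable (fun u : ℝ => (x - y) * deriv f (u * x + (1 - u) * y))
        volume 0 1 :=
      ((intervalIntegrable_iff_integrableOn_Icc_of_le zero_le_one).2 hint).const_mul _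
    have hFTC := intervalIntegral.integral_eq_sub_of_hasDerivAt (fun u _ => hderiv u) hI
    rw [intervalIntegral.integral_const_mul, intervalIntegral.integral_of_le zero_le_one,
      ← integral_Icc_eq_integral_Ioc] at hFTC
    rw [eq_div_iff (sub_ne_zero.2 h), mul_comm, hFTC]
    simp

/-- Given `(X, Y)`, the variable `U X + (1 - U) Y` is uniform on the segment between `Y` and `X`, so
`f'` averages to the difference quotient. Integrability of `f'` on almost every segment comes
from Fubini's theorem. -/
theorem integral_deriv_interpolation {Ω : Type*} [MeasurableSpace Ω] {P : Measure Ω}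
    [IsProbabilityMeasure P] {U X Y : Ω → ℝ} (hU : Measurable U) (hX : Measurable X)
    (hY : Measurable Y) (hlaw : P.map U = volume.restrict (Set.Icc (0 : ℝ) 1))
    (hind : IndepFun U (fun ω => (X ω, Y ω)) P) {f : ℝ → ℝ} (hf : Differentiable ℝ f)
    (hint : Integrable (fun ω => deriv f (U ω * X ω + (1 - U ω) * Y ω)) P) :
    ∫ ω, deriv f (U ω * X ω + (1 - U ω) * Y ω) ∂P = ∫ ω, diffQuot f (X ω) (Y ω) ∂P := by
  set V : Ω → ℝ × ℝ := fun ω => (X ω, Y ω) with hV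
  have hVm : Measurable V := hX.prodMk hY
  have hprod := (indepFun_iff_map_prod_eq_prod_map_map hU.aemeasurable hVm.aemeasurable).1 hind
  have := Measure.isProbabilityMeasure_map (μ := P) hU.aemeasurable
  have := Measure.isProbabilityMeasure_map (μ := P) hVm.aemeasurable
  set G : ℝ × ℝ × ℝ → ℝ := fun z => deriv f (z.1 * z.2.1 + (1 - z.1) * z.2.2) with hG
  have hGm : Measurable G := (measurable_deriv f).comp (by fun_prop)
  have hpair : Measurable fun ω => (U ω, V ω) := hU.prodMk hVm
  have hGint : Integrable G ((P.map U).prod (P.map V)) := by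
    rw [← hprod, integrable_map_measure hGm.aestronglyMeasurable hpair.aemeasurable]
    exact hint
  have h1 : ∫ ω, deriv f (U ω * X ω + (1 - U ω) * Y ω) ∂P =
      ∫ v, ∫ u, G (u, v) ∂(P.map U) ∂(P.map V) := by
    rw [← integral_prod_symm _ hGint, ← hprod,
      integral_map hpair.aemeasurable hGm.aestronglyMeasurable]
  have hfm : Measurable fun v : ℝ × ℝ => diffQuot f v.1 v.2 :=
    Measurable.ite (measurableSet_eq_fun measurable_fst measurable_snd)
      ((measurable_deriv f).comp measurable_fst)
      (((hf.continuous.measurable.comp measurable_fst).sub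
        (hf.continuous.measurable.comp measurable_snd)).div (measurable_fst.sub measurable_snd))
  have h2 : ∫ ω, diffQuot f (X ω) (Y ω) ∂P = ∫ v, diffQuot f v.1 v.2 ∂(P.map V) :=
    (integral_map hVm.aemeasurable hfm.aestronglyMeasurable).symm
  rw [h1, h2]
  refine integral_congr_ae ?_
  filter_upwards [hGint.prod_left_ae] with v hv
  rw [hlaw] at hv ⊢
  exact setIntegral_deriv_segment hf v.1 v.2 hv

theorem integral_comp_perm {n : ℕ} {d : Fin n → Fin n → ℝ} {Ω : Type*} [MeasurableSpace Ω]
    {P : Measure Ω} {π : Ω → Equiv.Perm (Fin n)} {I J K L : Ω → Fin n}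
    (h : IsCouplingInput P d π I J K L) (g : Equiv.Perm (Fin n) → ℝ) :
    ∫ ω, g (π ω) ∂P = ((fpfInvolutions n).card : ℝ)⁻¹ * ∑ σ ∈ fpfInvolutions n, g σ := by
  rw [← integral_uniformOn_finset, ← h.law_perm, integral_map h.measurable_perm.aemeasurable
    Measurable.of_discrete.aestronglyMeasurable]

theorem measurable_indices {n : ℕ} {d : Fin n → Fin n → ℝ} {Ω : Type*} [MeasurableSpace Ω]
    {P : Measure Ω} {π : Ω → Equiv.Perm (Fin n)} {I J K L : Ω → Fin n}
    (h : IsCouplingInput P d π I J K L) :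
    Measurable fun ω => (I ω, J ω, K ω, L ω) :=
  h.measurable_I.prodMk (h.measurable_J.prodMk (h.measurable_K.prodMk h.measurable_L))

theorem integral_eq_couplingMean {n : ℕ} {d : Fin n → Fin n → ℝ} {Ω : Type*} [MeasurableSpace Ω]
    {P : Measure Ω} [IsProbabilityMeasure P] {π : Ω → Equiv.Perm (Fin n)} {I J K L : Ω → Fin n}
    (h : IsCouplingInput P d π I J K L)
    (F : Equiv.Perm (Fin n) → Fin n → Fin n → Fin n → Fin n → ℝ) :
    ∫ ω, F (π ω) (I ω) (J ω) (K ω) (L ω) ∂P = couplingMean d F := by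
  have hq := measurable_indices h
  have hprod := (indepFun_iff_map_prod_eq_prod_map_map h.measurable_perm.aemeasurable
    hq.aemeasurable).1 h.indep
  have := Measure.isProbabilityMeasure_map (μ := P) h.measurable_perm.aemeasurable
  have := Measure.isProbabilityMeasure_map (μ := P) hq.aemeasurable
  set G : Equiv.Perm (Fin n) × Fin n × Fin n × Fin n × Fin n → ℝ :=
    fun z => F z.1 z.2.1 z.2.2.1 z.2.2.2.1 z.2.2.2.2
  have h1 : ∫ ω, F (π ω) (I ω) (J ω) (K ω) (L ω) ∂P =
      ∫ q, ∫ σ, G (σ, q) ∂(P.map π) ∂(P.map fun ω => (I ω, J ω, K ω, L ω)) := by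
    rw [← integral_prod_symm _ Integrable.of_finite, ← hprod,
      integral_map (h.measurable_perm.prodMk hq).aemeasurable
        Measurable.of_discrete.aestronglyMeasurable]
  rw [h1, integral_fintype Integrable.of_finite]
  simp only [Fintype.sum_prod_type, couplingMean, smul_eq_mul, h.law_perm,
    integral_uniformOn_finset]
  refine Finset.sum_congr rfl fun i _ => Finset.sum_congr rfl fun j _ =>
    Finset.sum_congr rfl fun k _ => Finset.sum_congr rfl fun l _ => ?_
  rw [map_measureReal_apply hq (MeasurableSet.singleton _), ← h.law_indices]
  congr 2
  ext ω
  simp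

theorem ae_mem_and_card_eq_four {n : ℕ} {d : Fin n → Fin n → ℝ} {Ω : Type*} [MeasurableSpace Ω]
    {P : Measure Ω} [IsProbabilityMeasure P] {π : Ω → Equiv.Perm (Fin n)} {I J K L : Ω → Fin n}
    (h : IsCouplingInput P d π I J K L) :
    ∀ᵐ ω ∂P, π ω ∈ fpfInvolutions n ∧ ({I ω, J ω, K ω, L ω} : Finset (Fin n)).card = 4 := by
  classical
  set good : Equiv.Perm (Fin n) × Fin n × Fin n × Fin n × Fin n → Prop := fun z =>
    z.1 ∈ fpfInvolutions n ∧ ({z.2.1, z.2.2.1, z.2.2.2.1, z.2.2.2.2} : Finset (Fin n)).card = 4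
  have hm : MeasurableSet {ω | ¬ good (π ω, I ω, J ω, K ω, L ω)} :=
    (h.measurable_perm.prodMk (measurable_indices h))
      (MeasurableSet.of_discrete (s := {z | ¬ good z}))
  have h0 := integral_eq_couplingMean h fun σ i j k l => if ¬ good (σ, i, j, k, l) then 1 else 0
  have h1 : couplingMean d
      (fun σ i j k l => if ¬ good (σ, i, j, k, l) then (1 : ℝ) else 0) = 0 := by
    refine Finset.sum_eq_zero fun i _ => Finset.sum_eq_zero fun j _ => Finset.sum_eq_zero fun k _ =>
      Finset.sum_eq_zero fun l _ => ?_
    by_cases hq : ({i, j, k, l} : Finset (Fin n)).card = 4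
    · rw [Finset.sum_eq_zero fun σ hσ => if_neg (not_not.2 ⟨hσ, hq⟩), mul_zero, mul_zero]
    · simp [quadProb, quadWeight, hq]
  rw [h1] at h0
  have h2 : ∫ ω, (if ¬ good (π ω, I ω, J ω, K ω, L ω) then (1 : ℝ) else 0) ∂P =
      P.real {ω | ¬ good (π ω, I ω, J ω, K ω, L ω)} := by
    rw [← integral_indicator_one hm]
    exact integral_congr_ae (ae_of_all _ fun ω => by simp [Set.indicator_apply])
  rw [h2, measureReal_eq_zero_iff] at h0
  exact h0

theorem theorem4p2 {n : ℕ} (hn : Even n) (d : Fin n → Fin n → ℝ) (hd : IsStandardArray d)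
    {Ω : Type*} [MeasurableSpace Ω] (P : Measure Ω) [IsProbabilityMeasure P]
    (π πdag πddag : Ω → Equiv.Perm (Fin n)) (I J K L : Ω → Fin n) (U : Ω → ℝ)
    (hinput : IsCouplingInput P d π I J K L)
    (hπdag : ∀ ω, πdag ω = piDag (π ω) (I ω) (J ω) (K ω) (L ω))
    (hπddag : ∀ ω, πddag ω = piDDag (π ω) (I ω) (J ω) (K ω) (L ω))
    (W Wdag Wddag Wstar : Ω → ℝ)
    (hW : ∀ ω, W ω = ∑ i, d i (π ω i))
    (hWdag : ∀ ω, Wdag ω = ∑ i, d i (πdag ω i))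
    (hWddag : ∀ ω, Wddag ω = ∑ i, d i (πddag ω i))
    (hUmeas : Measurable U)
    (hUlaw : P.map U = volume.restrict (Set.Icc (0 : ℝ) 1))
    (hUindep : IndepFun U (fun ω => (Wdag ω, Wddag ω)) P)
    (hWstar : ∀ ω, Wstar ω = U ω * Wdag ω + (1 - U ω) * Wddag ω)
    (𝓘 : Ω → Finset (Fin n))
    (h𝓘 : ∀ ω, 𝓘 ω = indexSet (π ω) (I ω) (J ω) (K ω) (L ω))
    (S T Tdag Tddag : Ω → ℝ)
    (hS : ∀ ω, S ω = ∑ i ∈ (𝓘 ω)ᶜ, d i (π ω i))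
    (hT : ∀ ω, T ω = ∑ i ∈ 𝓘 ω, d i (π ω i))
    (hTdag : ∀ ω, Tdag ω = ∑ i ∈ 𝓘 ω, d i (πdag ω i))
    (hTddag : ∀ ω, Tddag ω = ∑ i ∈ 𝓘 ω, d i (πddag ω i)) :
    (∀ᵐ ω ∂P, W ω = S ω + T ω ∧ Wdag ω = S ω + Tdag ω ∧ Wddag ω = S ω + Tddag ω) ∧
    HasZeroBiasDistribution P W Wstar ∧
    (9 ≤ n → Integrable (fun ω => W ω - Wstar ω) P ∧
      ∫ ω, |W ω - Wstar ω| ∂P ≤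
        112 * betaArray d / n + 672 * betaArray d / (n : ℝ) ^ 2
          + 192 * betaArray d / (n : ℝ) ^ 3) := by
  have eW : W = fun ω => permSum d (π ω) := funext hW
  have eWd : Wdag = fun ω => permSum d (piDag (π ω) (I ω) (J ω) (K ω) (L ω)) :=
    funext fun ω => by rw [hWdag, hπdag]; rfl
  have eWdd : Wddag = fun ω => permSum d (piDDag (π ω) (I ω) (J ω) (K ω) (L ω)) :=
    funext fun ω => by rw [hWddag, hπddag]; rfl
  have hgood := ae_mem_and_card_eq_four hinput
  have hpair := hinput.measurable_perm.prodMk (measurable_indices hinput)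
  have hmeas : ∀ F : Equiv.Perm (Fin n) → Fin n → Fin n → Fin n → Fin n → ℝ,
      Measurable fun ω => F (π ω) (I ω) (J ω) (K ω) (L ω) := fun F =>
    (Measurable.of_discrete
      (f := fun z : Equiv.Perm (Fin n) × Fin n × Fin n × Fin n × Fin n =>
        F z.1 z.2.1 z.2.2.1 z.2.2.2.1 z.2.2.2.2)).comp hpair
  have mWd : Measurable Wdag := eWd ▸ hmeas fun π i j k l => permSum d (piDag π i j k l)
  have mWdd : Measurable Wddag := eWdd ▸ hmeas fun π i j k l => permSum d (piDDag π i j k l)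
  have mW : Measurable W := eW ▸ hmeas fun π _ _ _ _ => permSum d π
  have eWs : Wstar = fun ω => U ω * Wdag ω + (1 - U ω) * Wddag ω := funext hWstar
  have mWs : Measurable Wstar :=
    eWs ▸ (hUmeas.mul mWd).add ((measurable_const.sub hUmeas).mul mWdd)
  refine ⟨?_, ⟨?_, ?_, mWs.aemeasurable, ?_⟩, fun hn9 => ?_⟩
  · filter_upwards [hgood] with ω ⟨hmem, hq⟩
    have hoff : ∀ m ∈ (𝓘 ω)ᶜ, πdag ω m = π ω m := fun m hm => by
      rw [hπdag]; rw [Finset.mem_compl, h𝓘] at hm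
      exact piDag_apply_of_notMem _ hm
    have hoff' : ∀ m ∈ (𝓘 ω)ᶜ, πddag ω m = π ω m := fun m hm => by
      rw [← hoff m hm, hπdag, hπddag]; rw [Finset.mem_compl, h𝓘] at hm
      exact piDDag_apply_of_notMem hmem hq fun h => hm (subset_indexSet _ _ _ _ _ h)
    refine ⟨?_, ?_, ?_⟩
    · rw [hW, hS, hT, Finset.sum_compl_add_sum]
    · rw [hWdag, hS, hTdag, ← Finset.sum_compl_add_sum (𝓘 ω)]
      congr 1
      exact Finset.sum_congr rfl fun m hm => by rw [hoff m hm]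
    · rw [hWddag, hS, hTddag, ← Finset.sum_compl_add_sum (𝓘 ω)]
      congr 1
      exact Finset.sum_congr rfl fun m hm => by rw [hoff' m hm]
  · have := Measure.isProbabilityMeasure_map (μ := P) hinput.measurable_perm.aemeasurable
    rw [eW]
    exact (MemLp.of_discrete (μ := P.map π) (f := permSum d)).comp_of_map
      hinput.measurable_perm.aemeasurable
  · rw [eW, integral_comp_perm hinput, sum_permSum_eq_zero hd, mul_zero]
  · intro f hf _ hint
    have hvar : Var[W; P] = 1 := by
      rw [← hd.sigmaSq_eq_one, sigmaSq, ← hinput.law_perm, variance_map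
        Measurable.of_discrete.aemeasurable hinput.measurable_perm.aemeasurable, eW]
      rfl
    rw [eWs] at hint ⊢
    rw [hvar, one_mul, integral_deriv_interpolation hUmeas mWd mWdd hUlaw hUindep hf hint, eW, eWd,
      eWdd, integral_comp_perm hinput fun σ => permSum d σ * f (permSum d σ),
      ← couplingMean_diffQuot hd f, ← integral_eq_couplingMean hinput]
  · have hU : ∀ᵐ ω ∂P, U ω ∈ Set.Icc (0 : ℝ) 1 :=
      ae_of_ae_map hUmeas.aemeasurable (hUlaw ▸ ae_restrict_mem measurableSet_Icc)
    have hle : ∀ᵐ ω ∂P, |W ω - Wstar ω| ≤ gapBound d (π ω) (I ω) (J ω) (K ω) (L ω) := by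
      filter_upwards [hgood, hU] with ω ⟨hmem, hq⟩ hu
      rw [eWs, eW, eWd, eWdd]
      exact abs_sub_interpolation_le_gapBound hd hmem hq hu
    have hbound : Integrable (fun ω => gapBound d (π ω) (I ω) (J ω) (K ω) (L ω)) P := by
      have := Measure.isProbabilityMeasure_map (μ := P) hpair.aemeasurable
      exact (Integrable.of_finite (μ := P.map fun ω => (π ω, I ω, J ω, K ω, L ω))
        (f := fun z => gapBound d z.1 z.2.1 z.2.2.1 z.2.2.2.1 z.2.2.2.2)).comp_measurable hpair
    have hint : Integrable (fun ω => W ω - Wstar ω) P :=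
      hbound.mono' (mW.sub mWs).aestronglyMeasurable hle
    refine ⟨hint, (integral_mono_ae hint.abs hbound hle).trans ?_⟩
    rw [integral_eq_couplingMean hinput]
    exact couplingMean_gapBound_le hd hn9
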